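/- Let $p$ be a prime and let $G$ be a uniform pro-$p$ group, i.e. a topologically finitely generated pro-$p$ group such that $G/\overline{G^{p}}$ (or $G/\overline{G^{4}}$ if $p=2$) is abelian and such that all the successive quotients $P_i(G)/P_{i+1}(G)$ of the lower $p$-series $P_1(G)=G$, $P_{i+1}(G)=\overline{P_i(G)^p[P_i(G),G]}$ have the same order. Let $R$ be a Banach–Tate $\mathbb{Z}_p$-algebra: a commutative ring, complete for a norm $|\cdot|$ satisfying $|0|=0$, $|1|=1$, $|x|=0$ only if $x=0$, $|x+y|\le\max(|x|,|y|)$ and $|xy|\le|x||y|$, which contains a unit $\varpi$ with $|\varpi|<1$ and $|\varpi s|=|\varpi||s|$ for all $s\in R$, together with a ring homomorphism $\mathbb{Z}_p\to R$ with $|z|\le|z|_p$ for all $z\in\mathbb{Z}_p$ (where $|p|_p=p^{-1}$). Let $R_0=\{x\in R: |x|\le 1\}$ and let $R[[G]]=\bigl(\varprojlim_N R_0[G/N]\bigr)[1/\varpi]$, where $N$ runs over the open normal subgroups of $G$. Fix $r\in[1/p,1)$. Let $g_1,\dots,g_d$ be a minimal ordered set of topological generators of $G$, and put $b_i=[g_i]-1$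 and $\mathbf{b}^\alpha=b_1^{\alpha_1}\cdots b_d^{\alpha_d}$ and $|\alpha|=\alpha_1+\dots+\alpha_d$ for $\alpha\in\mathbb{Z}_{\ge0}^d$. Every $\mu\in R[[G]]$ has a unique expansion $\mu=\sum_\alpha d_\alpha\mathbf{b}^\alpha$ with $(d_\alpha)$ a bounded family in $R$ (the sum converging in the inverse limit topology, i.e. coefficientwise in every $R[G/N]$), so that the $r$-norm $$\|\mu\|_r=\sup_\alpha|d_\alpha|\,r^{|\alpha|}$$ is well defined and finite. Moreover: 1. $\|\cdot\|_r$ does not depend on the choice of the minimal ordered set of topological generators of $G$. 2. $\|\mu\nu\|_r\le\|\mu\|_r\,\|\nu\|_r$ for all $\mu,\nu\in R[[G]]$. 3. Let $|\cdot|'$ be another norm on the ring $R$ (satisfying the same conditions $|1|'=1$, $|x+y|'\le\max(|x|',|y|')$, $|xy|'\le|x|'|y|'$, $|x|'=0$ only if $x=0$) with $|z|'\le|z|_p$ for all $z\in\mathbb{Z}_p$, which is bounded-equivalent to $|\cdot|$, i.e. there are constants $C_1,C_2>0$ with $C_1|x|\le|x|'\le C_2|x|$ for all $x\in R$. Then $\|\cdot\|'_r$,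 defined by $\|\sum_\alpha d_\alpha\mathbf{b}^\alpha\|'_r=\sup_\alpha|d_\alpha|'r^{|\alpha|}$, is bounded-equivalent to $\|\cdot\|_r$ on $R[[G]]$. -/

import Mathlib

/-! ### Uniform pro-`p` groups -/

section Groups

variable {G : Type*} [Group G] [TopologicalSpace G]

/-- A subset of a topological group generates it topologically if the only closed subgroup
containing it is the whole group. -/
def TopologicallyGenerates (S : Set G) : Prop :=
  closure (Subgroup.closure S : Set G) = Set.univ

/-- `g 0, …, g (d - 1)` is a minimal ordered set of topological generators: it generates `G`
topologically and this fails as soon as any one of its members is left out. In particular the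
members are pairwise distinct. -/
structure IsMinimalGenerators {d : ℕ} (g : Fin d → G) : Prop where
  generates : TopologicallyGenerates (Set.range g)
  minimal : ∀ i, ¬ TopologicallyGenerates (g '' {j | j ≠ i})

/-- A pro-`p` group: a profinite group all of whose open normal subgroups have index a power
of `p`. (A totally disconnected topological group is Hausdorff.) -/
structure IsProPGroup (p : ℕ) (G : Type*) [Group G] [TopologicalSpace G]
    [IsTopologicalGroup G] : Prop where
  compact : CompactSpace G
  totallyDisconnected : TotallyDisconnectedSpace G
  index : ∀ N : OpenNormalSubgroup G, ∃ k : ℕ, (N : Subgroup G).index = p ^ k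

variable (G) (p : ℕ) [IsTopologicalGroup G]

/-- The closed subgroup generated by the `n`-th powers of the elements of `G`. -/
def powerSubgroup (n : ℕ) : Subgroup G :=
  (Subgroup.closure {y : G | ∃ x : G, y = x ^ n}).topologicalClosure

/-- The lower `p`-series, indexed from `0`: the first term is `G`, and `P` is followed by the
closure of `P ^ p [P, G]`, where `P ^ p` is the subgroup generated by the `p`-th powers of the
elements of `P`. -/
def lowerPSeries : ℕ → Subgroup G
  | 0 => ⊤
  | i + 1 => (Subgroup.closure {y : G | ∃ x ∈ lowerPSeries i, y = x ^ p} ⊔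
      ⁅lowerPSeries i, (⊤ : Subgroup G)⁆).topologicalClosure

/-- A uniform pro-`p` group: a topologically finitely generated pro-`p` group which is powerful
(`G` modulo the closure of `G ^ p`, or of `G ^ 4` if `p = 2`, is abelian) and in which all
successive quotients of the lower `p`-series have the same order. -/
structure IsUniformProPGroup (p : ℕ) (G : Type*) [Group G] [TopologicalSpace G]
    [IsTopologicalGroup G] : Prop extends IsProPGroup p G where
  finitelyGenerated : ∃ S : Set G, S.Finite ∧ TopologicallyGenerates S
  powerful : commutator G ≤ powerSubgroup G (if p = 2 then 4 else p)
  uniform : ∀ i : ℕ, (lowerPSeries G p (i + 1)).relIndex (lowerPSeries G p i) =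
    (lowerPSeries G p 1).relIndex (lowerPSeries G p 0)

end Groups

/-! ### Norms -/

/-- Two real-valued functions are bounded-equivalent if each is at most a constant times the
other. -/
def BoundedEquivalent {X : Type*} (f f' : X → ℝ) : Prop :=
  ∃ C₁ C₂ : ℝ, 0 < C₁ ∧ 0 < C₂ ∧ ∀ x, C₁ * f x ≤ f' x ∧ f' x ≤ C₂ * f x

/-- A multiplicative pseudo-uniformizer of a normed ring. -/
def IsMultiplicativePseudoUniformizer {R : Type*} [NormedCommRing R] (ϖ : R) : Prop :=
  IsUnit ϖ ∧ ‖ϖ‖ < 1 ∧ ∀ s : R, ‖ϖ * s‖ = ‖ϖ‖ * ‖s‖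

/-- A complete non-archimedean normed ring `R` with `‖1‖ = 1` is a Banach–Tate `ℤ_p`-algebra if
it has a multiplicative pseudo-uniformizer and is equipped with a norm-decreasing homomorphism
from `ℤ_p`. -/
structure IsBanachTateAlgebra (p : ℕ) [Fact p.Prime] (R : Type*) [NormedCommRing R]
    [NormOneClass R] [IsUltrametricDist R] [CompleteSpace R] [Algebra ℤ_[p] R] : Prop where
  exists_pseudoUniformizer : ∃ ϖ : R, IsMultiplicativePseudoUniformizer ϖ
  norm_algebraMap_le : ∀ z : ℤ_[p], ‖algebraMap ℤ_[p] R z‖ ≤ ‖z‖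

/-- A non-archimedean submultiplicative norm on a `ℤ_p`-algebra with value `1` at `1` and for
which the structure map is norm-decreasing. -/
structure IsZpAlgebraNorm (p : ℕ) [Fact p.Prime] {R : Type*} [CommRing R] [Algebra ℤ_[p] R]
    (f : RingNorm R) : Prop where
  map_one : f 1 = 1
  map_add_le_max : ∀ x y : R, f (x + y) ≤ max (f x) (f y)
  map_algebraMap_le : ∀ z : ℤ_[p], f (algebraMap ℤ_[p] R z) ≤ ‖z‖

/-! ### Completed group rings -/

section CompletedGroupRing

variable {R : Type*} [NormedCommRing R] [IsUltrametricDist R]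

lemma norm_coeff_mul_le {H : Type*} [Group H] (x y : MonoidAlgebra R H) {C D : ℝ}
    (hC : 0 ≤ C) (hD : 0 ≤ D) (hx : ∀ h, ‖x.coeff h‖ ≤ C) (hy : ∀ h, ‖y.coeff h‖ ≤ D) (h : H) :
    ‖(x * y).coeff h‖ ≤ C * D := by
  classical
  rw [MonoidAlgebra.coeff_mul]
  simp only [Finsupp.sum]
  have hCD : 0 ≤ C * D := mul_nonneg hC hD
  refine IsUltrametricDist.norm_sum_le_of_forall_le_of_nonneg hCD fun a _ => ?_
  refine IsUltrametricDist.norm_sum_le_of_forall_le_of_nonneg hCD fun b _ => ?_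
  split_ifs
  · exact (norm_mul_le _ _).trans (mul_le_mul (hx a) (hy b) (norm_nonneg _) hC)
  · simpa using hCD

variable (R) (G : Type*) [Group G] [TopologicalSpace G]

/-- The completed group ring `R[[G]] = (lim R₀[G/N])[1/ϖ]`, where `N` runs over the open normal
subgroups of `G`, `R₀` is the unit ball of `R` and `ϖ` is a multiplicative pseudo-uniformizer.
It is realised inside `∏ R[G/N]` as the ring of compatible families with bounded coefficients;
see `mem_completedGroupRing_iff` for the comparison with inverting `ϖ`. -/
def CompletedGroupRing :
    Subalgebra R ((N : OpenNormalSubgroup G) → MonoidAlgebra R (G ⧸ (N : Subgroup G))) where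
  carrier := {x |
    (∀ (N M : OpenNormalSubgroup G) (h : (N : Subgroup G) ≤ (M : Subgroup G)),
      MonoidAlgebra.mapDomainRingHom R
        (QuotientGroup.map (N : Subgroup G) (M : Subgroup G) (MonoidHom.id G) h) (x N) = x M) ∧
    ∃ C : ℝ, 0 ≤ C ∧ ∀ (N : OpenNormalSubgroup G) (h : G ⧸ (N : Subgroup G)),
      ‖(x N).coeff h‖ ≤ C}
  mul_mem' := by
    rintro x y ⟨hx, C, hC, hxC⟩ ⟨hy, D, hD, hyD⟩
    refine ⟨fun N M h => ?_, C * D, mul_nonneg hC hD, fun N h => ?_⟩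
    · rw [Pi.mul_apply, Pi.mul_apply, map_mul, hx N M h, hy N M h]
    · exact norm_coeff_mul_le _ _ hC hD (hxC N) (hyD N) h
  add_mem' := by
    rintro x y ⟨hx, C, hC, hxC⟩ ⟨hy, D, hD, hyD⟩
    refine ⟨fun N M h => ?_, max C D, le_max_of_le_left hC, fun N h => ?_⟩
    · rw [Pi.add_apply, Pi.add_apply, map_add, hx N M h, hy N M h]
    · exact (IsUltrametricDist.norm_add_le_max _ _).trans (max_le_max (hxC N h) (hyD N h))
  algebraMap_mem' := by
    classical
    intro a
    refine ⟨fun N M h => ?_, ‖a‖, norm_nonneg a, fun N h => ?_⟩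
    · simp [MonoidAlgebra.coe_algebraMap]
    · simp only [Pi.algebraMap_apply, MonoidAlgebra.coe_algebraMap, Function.comp_apply,
        MonoidAlgebra.coeff_single, Finsupp.single_apply]
      split_ifs <;> simp

/-- For a multiplicative pseudo-uniformizer `ϖ`, a compatible family lies in `R[[G]]` if and only
if some `ϖ ^ n` times it has all its coefficients in the unit ball of `R`. -/
lemma mem_completedGroupRing_iff [NormOneClass R] {ϖ : R}
    (hϖ : IsMultiplicativePseudoUniformizer ϖ)
    (x : (N : OpenNormalSubgroup G) → MonoidAlgebra R (G ⧸ (N : Subgroup G))) :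
    x ∈ CompletedGroupRing R G ↔
      (∀ (N M : OpenNormalSubgroup G) (h : (N : Subgroup G) ≤ (M : Subgroup G)),
        MonoidAlgebra.mapDomainRingHom R
          (QuotientGroup.map (N : Subgroup G) (M : Subgroup G) (MonoidHom.id G) h) (x N) = x M) ∧
      ∃ n : ℕ, ∀ (N : OpenNormalSubgroup G) (h : G ⧸ (N : Subgroup G)),
        ‖ϖ ^ n * (x N).coeff h‖ ≤ 1 := by
  obtain ⟨hu, h1, hm⟩ := hϖ
  have hpow : ∀ (n : ℕ) (s : R), ‖ϖ ^ n * s‖ = ‖ϖ‖ ^ n * ‖s‖ := by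
    intro n s
    induction n with
    | zero => simp
    | succ n ih => rw [pow_succ', mul_assoc, hm, ih, pow_succ', mul_assoc]
  have : Nontrivial R := NormOneClass.nontrivial
  have h0 : 0 < ‖ϖ‖ := norm_pos_iff.mpr hu.ne_zero
  refine and_congr_right fun _ => ⟨?_, ?_⟩
  · rintro ⟨C, hC, hx⟩
    obtain ⟨n, hn⟩ := exists_pow_lt_of_lt_one (inv_pos.mpr (show 0 < C + 1 by linarith)) h1
    refine ⟨n, fun N h => ?_⟩
    rw [hpow]
    calc ‖ϖ‖ ^ n * ‖(x N).coeff h‖ ≤ (C + 1)⁻¹ * (C + 1) :=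
          mul_le_mul hn.le ((hx N h).trans (by linarith)) (norm_nonneg _) (by positivity)
      _ = 1 := inv_mul_cancel₀ (by linarith)
  · rintro ⟨n, hn⟩
    refine ⟨(‖ϖ‖ ^ n)⁻¹, by positivity, fun N h => ?_⟩
    have := hn N h
    rw [hpow] at this
    rw [← one_div, le_div_iff₀ (by positivity), mul_comm]
    exact this

variable {G}

/-- The group element `[g]` of `R[[G]]`. -/
noncomputable def groupElement (g : G) : CompletedGroupRing R G :=
  ⟨fun N => MonoidAlgebra.single (QuotientGroup.mk g) 1, by
    classical
    refine ⟨fun N M h => ?_, ‖(1 : R)‖, norm_nonneg _, fun N h => ?_⟩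
    · simp only [MonoidAlgebra.mapDomainRingHom_apply, MonoidAlgebra.mapDomain_single]
      rfl
    · simp only [MonoidAlgebra.coeff_single, Finsupp.single_apply]
      split_ifs <;> simp⟩

/-- The ordered monomial `b ^ α = b 0 ^ α 0 * ⋯ * b (d - 1) ^ α (d - 1)`, where
`b i = [g i] - 1`. -/
noncomputable def monomial {d : ℕ} (g : Fin d → G) (α : Fin d → ℕ) : CompletedGroupRing R G :=
  (List.ofFn fun i => (groupElement R (g i) - 1) ^ α i).prod

variable {R}

/-- `IsExpansion g μ c` says that `μ = ∑ c_α b ^ α` with coefficients `c_α` in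
`R₀[1/ϖ]`, uniformly in `α`: the family `c` is bounded and the series converges to `μ` in the
inverse limit topology, that is, coefficientwise in every `R[G/N]`. -/
structure IsExpansion {d : ℕ} (g : Fin d → G) (μ : CompletedGroupRing R G)
    (c : (Fin d → ℕ) → R) : Prop where
  bounded : ∃ C : ℝ, ∀ α, ‖c α‖ ≤ C
  hasSum : ∀ (N : OpenNormalSubgroup G) (h : G ⧸ (N : Subgroup G)),
    HasSum (fun α => c α * ((monomial R g α).1 N).coeff h) ((μ.1 N).coeff h)

open Classical in
/-- The family of coefficients of `μ` in its expansion `μ = ∑ c_α b ^ α`. -/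
noncomputable def expansionCoeff {d : ℕ} (g : Fin d → G) (μ : CompletedGroupRing R G) :
    (Fin d → ℕ) → R :=
  if h : ∃ c, IsExpansion g μ c then h.choose else 0

/-- The `r`-norm of `μ = ∑ c_α b ^ α` with respect to the generators `g` and a norm `f` on the
coefficient ring: the supremum of `f (c_α) * r ^ |α|`. -/
noncomputable def rNorm (f : R → ℝ) (r : ℝ) {d : ℕ} (g : Fin d → G)
    (μ : CompletedGroupRing R G) : ℝ :=
  ⨆ α : Fin d → ℕ, f (expansionCoeff g μ α) * r ^ (∑ i, α i)

end CompletedGroupRing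

/-! ### The lower `p`-series `P_0 = G, P_1, P_2, …` of a topological group. -/

section LowerPSeries

open scoped commutatorElement

variable {G : Type*} [Group G] [TopologicalSpace G] [IsTopologicalGroup G] {p : ℕ}

/-! Write `P_k` for `lowerPSeries G p k`, so that `P_0 = G`. The group theory supplies coordinates:
every class of `G/P_k` is `g_1^{n_1} ⋯ g_d^{n_d}` for a vector `n` that is unique modulo `p^k`.
Existence uses that the `p^k`-th powers of the generators generate `P_k` modulo `P_{k+1}` and are
central there. Uniqueness is a count: minimality gives `|G/P_1| = p^d`, and uniformity then gives
`|G/P_k| = p^{dk}` (`bijective_mk_orderedPow`).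

Since `[g^n] = ∏ (1 + b_j)^{n_j} = ∑ binom(n,α) b^α`, the coefficient of `b^α` should be the
functional `[g^n] ↦ binom(n,α)`. On `R[G/P_k]` this makes sense up to an error divisible by `p^{k -
v_p(α!)}`, because `n` is known only modulo `p^k`. The resulting functionals converge as `k` grows,
by completeness; the limit `coeffFunctional` is dual to the monomials and continuous on bounded
sets, which gives uniqueness of expansions. Existence holds because monomials of large degree are
`p`-adically small in each `R[G/P_m]`.

The norm statements rest on one estimate, `norm_coeffFunctional_augProduct_le`: in a product of `l`
elements `[x] - 1`, with arbitrary `x` in `G`, the coefficient of `b^α` has norm at most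
`p^{-(l-|α|)}`. For `r ≥ 1/p` such a product therefore has `r`-norm at most `r^l`. A monomial in
another set of generators, or a product of two monomials, is such a product with `l` its total
degree, so independence of the generators and submultiplicativity follow from the ultrametric
inequality and continuity.

The estimate is proved in `ℤ[Q]` for `Q = G/P_k`. Let `J` be spanned by `p` and all `[x] - 1`.
Because `G` is powerful, elements `[x] - 1` commute modulo `pJ + J^3`, so products can be reordered
and `J^n` is spanned by the `p^a b^α` with `a + |α| ≥ n`, up to an arbitrarily high power of `J`
(`augModulo_pow_le_orderedSpan_ge_sup`). As `Q` is a finite `p`-group, high powers of `J` are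
divisible by high powers of `p`. -/

omit [TopologicalSpace G] [IsTopologicalGroup G] in
lemma closure_pow_normal (P : Subgroup G) [hP : P.Normal] :
    (Subgroup.closure {y : G | ∃ x ∈ P, y = x ^ p}).Normal := by
  constructor
  intro n hn g
  induction hn using Subgroup.closure_induction with
  | mem y hy =>
    obtain ⟨x, hx, rfl⟩ := hy
    exact Subgroup.subset_closure ⟨g * x * g⁻¹, hP.conj_mem x hx g, by rw [conj_pow]⟩
  | one => simp
  | mul x y _ _ hx hy => simpa [mul_assoc] using mul_mem hx hy
  | inv x _ hx => simpa [mul_assoc] using inv_mem hx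

lemma lowerPSeries_normal (i : ℕ) : (lowerPSeries G p i).Normal := by
  induction i with
  | zero => exact inferInstanceAs (⊤ : Subgroup G).Normal
  | succ i ih =>
    have h1 := closure_pow_normal (p := p) (lowerPSeries G p i)
    have h2 : (Subgroup.closure {y : G | ∃ x ∈ lowerPSeries G p i, y = x ^ p} ⊔
      ⁅lowerPSeries G p i, (⊤ : Subgroup G)⁆).Normal := inferInstance
    exact Subgroup.is_normal_topologicalClosure _

instance (i : ℕ) : (lowerPSeries G p i).Normal := lowerPSeries_normal i

lemma lowerPSeries_isClosed (i : ℕ) : IsClosed (lowerPSeries G p i : Set G) := by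
  cases i with
  | zero => exact isClosed_univ
  | succ i => exact Subgroup.isClosed_topologicalClosure _

lemma pow_mem_lowerPSeries {i : ℕ} {x : G} (hx : x ∈ lowerPSeries G p i) :
    x ^ p ∈ lowerPSeries G p (i + 1) :=
  Subgroup.le_topologicalClosure _
    (le_sup_left (α := Subgroup G) (Subgroup.subset_closure ⟨x, hx, rfl⟩))

lemma commutator_mem_lowerPSeries {i : ℕ} {x : G} (hx : x ∈ lowerPSeries G p i) (g : G) :
    ⁅x, g⁆ ∈ lowerPSeries G p (i + 1) :=
  Subgroup.le_topologicalClosure _ (le_sup_right (α := Subgroup G)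
    (Subgroup.commutator_mem_commutator hx (Subgroup.mem_top g)))

lemma pow_prime_pow_mem_lowerPSeries (x : G) (i : ℕ) : x ^ p ^ i ∈ lowerPSeries G p i := by
  induction i with
  | zero => exact Subgroup.mem_top _
  | succ i ih => rw [pow_succ, pow_mul]; exact pow_mem_lowerPSeries ih

/-- A closed subgroup contains the successor term as soon as it contains its generators. -/
lemma lowerPSeries_succ_le {i : ℕ} {H : Subgroup G} (hH : IsClosed (H : Set G))
    (hpow : ∀ x ∈ lowerPSeries G p i, x ^ p ∈ H)
    (hcomm : ∀ x ∈ lowerPSeries G p i, ∀ g : G, ⁅x, g⁆ ∈ H) : lowerPSeries G p (i + 1) ≤ H := by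
  refine Subgroup.topologicalClosure_minimal _ (sup_le ?_ ?_) hH
  · rw [Subgroup.closure_le]
    rintro _ ⟨x, hx, rfl⟩
    exact hpow x hx
  · rw [Subgroup.commutator_le]
    exact fun x hx g _ => hcomm x hx g

lemma lowerPSeries_antitone : Antitone (lowerPSeries G p) := by
  refine antitone_nat_of_succ_le fun i => ?_
  refine lowerPSeries_succ_le (lowerPSeries_isClosed i) (fun x hx => pow_mem hx p) fun x hx g => ?_
  rw [commutatorElement_def]
  have := mul_mem hx ((lowerPSeries_normal i).conj_mem _ (inv_mem hx) g)
  simpa [mul_assoc] using this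

/-- The images of the generators span a finitely generated abelian group of exponent dividing `p`,
which is finite. Being finite it is closed in `G/P_1`, and being dense it is everything. -/
lemma finite_quotient_lowerPSeries_one (hp : 0 < p)
    (hfg : ∃ S : Set G, S.Finite ∧ TopologicallyGenerates S) :
    Finite (G ⧸ lowerPSeries G p 1) := by
  obtain ⟨S, hS, hgen⟩ := hfg
  set P := lowerPSeries G p 1
  have : IsClosed (P : Set G) := lowerPSeries_isClosed 1
  have hcomm : ∀ a b : G ⧸ P, a * b = b * a := by
    intro a b
    induction a using QuotientGroup.induction_on with | _ a =>
    induction b using QuotientGroup.induction_on with | _ b =>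
    rw [← commutatorElement_eq_one_iff_mul_comm, ← QuotientGroup.mk'_apply, ← QuotientGroup.mk'_apply, ← map_commutatorElement,
      QuotientGroup.mk'_apply, QuotientGroup.eq_one_iff]
    exact commutator_mem_lowerPSeries (i := 0) (Subgroup.mem_top a) b
  let : CommGroup (G ⧸ P) := { (inferInstance : Group (G ⧸ P)) with mul_comm := hcomm }
  set T : Set (G ⧸ P) := QuotientGroup.mk' P '' S
  have hT : T.Finite := hS.image _
  have : Group.FG (Subgroup.closure T) := by
    have := hT.fintype
    exact Group.closure_finite_fg T
  have htor : IsMulTorsion (Subgroup.closure T) := by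
    rintro ⟨x, hx⟩
    rw [isOfFinOrder_iff_pow_eq_one]
    refine ⟨p, hp, Subtype.ext ?_⟩
    change x ^ p = 1
    induction x using QuotientGroup.induction_on with | _ x =>
    rw [← QuotientGroup.mk_pow, QuotientGroup.eq_one_iff]
    exact pow_mem_lowerPSeries (i := 0) (Subgroup.mem_top x)
  have hfin : Finite (Subgroup.closure T) :=
    CommGroup.finite_of_fg_isMulTorsion _ htor
  have hclosed : IsClosed (Subgroup.closure T : Set (G ⧸ P)) := by
    have : T1Space (G ⧸ P) := inferInstance
    exact Set.Finite.isClosed (Set.toFinite _)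
  have htop : ∀ x : G, QuotientGroup.mk' P x ∈ Subgroup.closure T := by
    intro x
    have h1 : x ∈ closure (Subgroup.closure S : Set G) := by
      rw [hgen]; exact Set.mem_univ x
    have h2 : IsClosed ((QuotientGroup.mk' P) ⁻¹' (Subgroup.closure T : Set (G ⧸ P))) :=
      hclosed.preimage QuotientGroup.continuous_mk
    refine closure_minimal ?_ h2 h1
    intro y hy
    change QuotientGroup.mk' P y ∈ Subgroup.closure T
    rw [← MonoidHom.map_closure]
    exact Subgroup.mem_map_of_mem _ hy
  have : (Subgroup.closure T) = ⊤ := by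
    rw [eq_top_iff]
    rintro x -
    induction x using QuotientGroup.induction_on with | _ x => exact htop x
  rw [this] at hfin
  exact Finite.of_equiv _ Subgroup.topEquiv.toEquiv

end LowerPSeries

/-! ### Powers of products in groups of class two, and elements central modulo a subgroup. -/

section Commutators

open scoped commutatorElement

/-- Collection formula in class two: moving `y^n` past `x` costs `c^n`, and these costs add up to `0
+ 1 + ⋯ + (n - 1)`. -/
lemma mul_pow_eq_of_mul_eq {H : Type*} [Group H] {x y c : H} (h : y * x = x * y * c)
    (hx : Commute c x) (hy : Commute c y) (n : ℕ) :
    (x * y) ^ n = x ^ n * y ^ n * c ^ n.choose 2 := by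
  have hyn : ∀ n : ℕ, y ^ n * x = x * y ^ n * c ^ n := by
    intro n
    induction n with
    | zero => simp
    | succ n ih =>
      calc y ^ (n + 1) * x = y ^ n * (y * x) := by rw [pow_succ, mul_assoc]
        _ = (y ^ n * x) * (y * c) := by rw [h]; simp only [mul_assoc]
        _ = x * y ^ n * (c ^ n * y) * c := by rw [ih]; simp only [mul_assoc]
        _ = x * y ^ (n + 1) * c ^ (n + 1) := by
          rw [(hy.pow_left n).eq, pow_succ, pow_succ]; simp only [mul_assoc]
  induction n with
  | zero => simp
  | succ n ih =>
    have hc : Commute (c ^ n.choose 2) (x * y) := (hx.mul_right hy).pow_left _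
    calc (x * y) ^ (n + 1) = x ^ n * y ^ n * (c ^ n.choose 2 * (x * y)) := by
          rw [pow_succ, ih]; simp only [mul_assoc]
      _ = x ^ n * (y ^ n * x) * y * c ^ n.choose 2 := by rw [hc.eq]; simp only [mul_assoc]
      _ = x ^ n * x * y ^ n * (c ^ n * y) * c ^ n.choose 2 := by
          rw [hyn]; simp only [mul_assoc]
      _ = x ^ (n + 1) * y ^ (n + 1) * c ^ (n + 1).choose 2 := by
          rw [(hy.pow_left n).eq, Nat.choose_succ_succ' n 1, Nat.choose_one_right, pow_add c,
            pow_succ x, pow_succ y]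
          simp only [mul_assoc]

variable {G : Type*} [Group G]

lemma commute_mk_iff {N : Subgroup G} [N.Normal] {x y : G} :
    Commute (x : G ⧸ N) (y : G ⧸ N) ↔ ⁅x, y⁆ ∈ N := by
  rw [← QuotientGroup.eq_one_iff, ← commutatorElement_eq_one_iff_commute]
  exact Iff.of_eq (congrArg (· = 1) (map_commutatorElement (QuotientGroup.mk' N) x y).symm)

lemma mk_mul_pow_eq {N : Subgroup G} [N.Normal] {x y : G} {n : ℕ}
    (hx : ⁅⁅y⁻¹, x⁻¹⁆, x⁆ ∈ N) (hy : ⁅⁅y⁻¹, x⁻¹⁆, y⁆ ∈ N) (hn : ⁅y⁻¹, x⁻¹⁆ ^ n.choose 2 ∈ N) :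
    (((x * y) ^ n : G) : G ⧸ N) = ((x ^ n * y ^ n : G) : G ⧸ N) := by
  have h : (y : G ⧸ N) * x = x * y * (⁅y⁻¹, x⁻¹⁆ : G) := by
    rw [← QuotientGroup.mk_mul, ← QuotientGroup.mk_mul, ← QuotientGroup.mk_mul,
      commutatorElement_def]
    congr 1
    group
  have := mul_pow_eq_of_mul_eq h (commute_mk_iff.mpr hx) (commute_mk_iff.mpr hy) n
  rw [← QuotientGroup.mk_pow N _ (n.choose 2), (QuotientGroup.eq_one_iff _).mpr hn, mul_one] at this
  exact_mod_cast this

/-- The elements of `G` which are central modulo the normal subgroup `N`. -/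
def centralModulo (N : Subgroup G) [N.Normal] : Subgroup G :=
  (Subgroup.center (G ⧸ N)).comap (QuotientGroup.mk' N)

lemma mem_centralModulo {N : Subgroup G} [N.Normal] {x : G} :
    x ∈ centralModulo N ↔ ∀ g, ⁅x, g⁆ ∈ N := by
  rw [centralModulo, Subgroup.mem_comap, Subgroup.mem_center_iff]
  constructor
  · intro h g
    exact commute_mk_iff.mp (h g).symm
  · intro h g
    induction g using QuotientGroup.induction_on with | _ g =>
    exact (commute_mk_iff.mpr (h g)).symm.eq

lemma le_centralModulo (N : Subgroup G) [N.Normal] : N ≤ centralModulo N := by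
  intro x hx
  rw [centralModulo, Subgroup.mem_comap, QuotientGroup.mk'_apply,
    (QuotientGroup.eq_one_iff x).mpr hx]
  exact one_mem _

lemma commutator_pow_mem {N : Subgroup G} [N.Normal] {x g : G} {n : ℕ}
    (h : (g * x * g⁻¹) ^ n * (x ^ n)⁻¹ ∈ N) : ⁅x ^ n, g⁆ ∈ N := by
  have h' := inv_mem h
  rw [conj_pow] at h'
  simpa [commutatorElement_def, mul_assoc] using h'

end Commutators

/-! ### Power structure of the lower `p`-series of a uniform group. -/

section Uniform

open scoped commutatorElement

variable {G : Type*} [Group G] [TopologicalSpace G] [IsTopologicalGroup G] {p : ℕ}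

lemma isClosed_of_isOpen_le {N H : Subgroup G} (hN : IsOpen (N : Set G)) (h : N ≤ H) :
    IsClosed (H : Set G) :=
  Subgroup.isClosed_of_isOpen _ (Subgroup.isOpen_mono h hN)

namespace IsUniformProPGroup

variable [Fact p.Prime] (hG : IsUniformProPGroup p G)

include hG

lemma finite_quotient_one : Finite (G ⧸ lowerPSeries G p 1) :=
  finite_quotient_lowerPSeries_one (Fact.out : p.Prime).pos hG.finitelyGenerated

lemma index_lowerPSeries (k : ℕ) :
    (lowerPSeries G p k).index = (lowerPSeries G p 1).index ^ k := by
  induction k with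
  | zero => simp [lowerPSeries]
  | succ k ih =>
    rw [← Subgroup.relIndex_mul_index (lowerPSeries_antitone k.le_succ), hG.uniform k, ih, pow_succ,
      mul_comm]
    simp [lowerPSeries]

lemma finiteIndex_lowerPSeries (k : ℕ) : (lowerPSeries G p k).FiniteIndex := by
  have := hG.finite_quotient_one
  rw [Subgroup.finiteIndex_iff, hG.index_lowerPSeries]
  exact pow_ne_zero _ (Subgroup.finiteIndex_of_finite_quotient.index_ne_zero)

lemma isOpen_lowerPSeries (k : ℕ) : IsOpen (lowerPSeries G p k : Set G) :=
  have := hG.finiteIndex_lowerPSeries k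
  Subgroup.isOpen_of_isClosed_of_finiteIndex _ (lowerPSeries_isClosed k)

/-- For `p = 2` the collection formula leaves the commutator itself, since `2.choose 2 = 1`; this
extra step down the series is what makes squaring multiplicative. -/
lemma commutator_mem_of_two (hp : p = 2) (i : ℕ) :
    ∀ x ∈ lowerPSeries G p i, ∀ g : G, ⁅x, g⁆ ∈ lowerPSeries G p (i + 2) := by
  induction i with
  | zero =>
    intro x _ g
    have h1 : ⁅x, g⁆ ∈ commutator G :=
      Subgroup.commutator_mem_commutator (Subgroup.mem_top _) (Subgroup.mem_top _)
    -- This is where the exponent 4 matters: fourth powers are `p^2`-th powers, hence two steps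
    -- down.
    have h2 : powerSubgroup G 4 ≤ lowerPSeries G p 2 := by
      refine Subgroup.topologicalClosure_minimal _ ?_ (lowerPSeries_isClosed 2)
      rw [Subgroup.closure_le]
      rintro _ ⟨y, rfl⟩
      have := pow_prime_pow_mem_lowerPSeries (p := p) y 2
      subst hp
      exact this
    have h3 := hG.powerful h1
    rw [if_pos hp] at h3
    exact h2 h3
  | succ i ih =>
    intro x hx
    rw [← mem_centralModulo]
    refine lowerPSeries_succ_le (isClosed_of_isOpen_le (hG.isOpen_lowerPSeries (i + 3))
      (le_centralModulo _)) (fun y hy => ?_) (fun y hy g => ?_) hx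
    · rw [mem_centralModulo]
      intro g
      refine commutator_pow_mem ?_
      have hc := inv_mem (ih y hy g)
      rw [commutatorElement_inv] at hc
      have h1 : g * y * g⁻¹ = ⁅g, y⁆ * y := by simp [commutatorElement_def]
      have h3 : ⁅y, ⁅g, y⁆⁆ ∈ lowerPSeries G p (i + 3) := by
        have := inv_mem (commutator_mem_lowerPSeries hc y)
        rwa [commutatorElement_inv] at this
      have h4 : ⁅g, y⁆ ^ 2 ∈ lowerPSeries G p (i + 3) := by
        have := pow_mem_lowerPSeries hc
        rwa [hp] at this ⊢
      have h5 : (⁅g, y⁆ * y) ^ 2 * (y ^ 2)⁻¹ =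
          ⁅g, y⁆ * ⁅y, ⁅g, y⁆⁆ * ⁅g, y⁆⁻¹ * ⁅g, y⁆ ^ 2 := by
        generalize ⁅g, y⁆ = c
        simp only [commutatorElement_def, pow_two, mul_inv_rev]
        group
      rw [h1, show (⁅g, y⁆ * y) ^ p * (y ^ p)⁻¹ = (⁅g, y⁆ * y) ^ 2 * (y ^ 2)⁻¹ by rw [hp], h5]
      exact mul_mem ((lowerPSeries_normal _).conj_mem _ h3 _) h4
    · exact mem_centralModulo.mpr (commutator_mem_lowerPSeries (ih y hy g))

/-- Two elements of a term of the lower `p`-series multiply like commuting ones under taking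
`p`-th powers, two steps further down. -/
lemma mk_mul_pow_prime {i : ℕ} {x y : G} (hx : x ∈ lowerPSeries G p i)
    (hy : y ∈ lowerPSeries G p i) :
    (((x * y) ^ p : G) : G ⧸ lowerPSeries G p (i + 2)) = ((x ^ p * y ^ p : G) : G ⧸ _) := by
  have hc : ⁅y⁻¹, x⁻¹⁆ ∈ lowerPSeries G p (i + 1) := commutator_mem_lowerPSeries (inv_mem hy) _
  refine mk_mul_pow_eq (commutator_mem_lowerPSeries hc _) (commutator_mem_lowerPSeries hc _) ?_
  by_cases hp : p = 2
  · exact pow_mem (hG.commutator_mem_of_two hp i _ (inv_mem hy) _) _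
  · have hpp : p.Prime := Fact.out
    obtain ⟨m, hm⟩ := hpp.dvd_choose_self two_ne_zero (lt_of_le_of_ne hpp.two_le (Ne.symm hp))
    rw [hm, pow_mul]
    exact pow_mem (pow_mem_lowerPSeries hc) m

/-- Modulo the next term, a term of the lower `p`-series is generated by the `p`-th powers of
the elements of the preceding one. -/
lemma lowerPSeries_succ_le_closure_pow (i : ℕ) :
    lowerPSeries G p (i + 1) ≤
      Subgroup.closure {y : G | ∃ x ∈ lowerPSeries G p i, y = x ^ p} ⊔ lowerPSeries G p (i + 2) := by
  have hclosed : ∀ i, IsClosed ((Subgroup.closure {y : G | ∃ x ∈ lowerPSeries G p i, y = x ^ p} ⊔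
      lowerPSeries G p (i + 2) : Subgroup G) : Set G) := fun i =>
    isClosed_of_isOpen_le (hG.isOpen_lowerPSeries (i + 2)) le_sup_right
  have hpow : ∀ i, ∀ x ∈ lowerPSeries G p i,
      x ^ p ∈ Subgroup.closure {y : G | ∃ x ∈ lowerPSeries G p i, y = x ^ p} ⊔
        lowerPSeries G p (i + 2) := fun i x hx =>
    le_sup_left (α := Subgroup G) (Subgroup.subset_closure ⟨x, hx, rfl⟩)
  by_cases hp : p = 2
  -- For `p = 2` commutators already fall two steps; for odd `p` they must be shown to be `p`-th
  -- powers modulo `P_{i+2}`, by induction from powerfulness.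
  · exact lowerPSeries_succ_le (hclosed i) (hpow i) fun x hx g =>
      le_sup_right (α := Subgroup G) (hG.commutator_mem_of_two hp i x hx g)
  have hpp : p.Prime := Fact.out
  induction i with
  | zero =>
    refine lowerPSeries_succ_le (hclosed 0) (hpow 0) fun x _ g => ?_
    have h1 : ⁅x, g⁆ ∈ commutator G :=
      Subgroup.commutator_mem_commutator (Subgroup.mem_top _) (Subgroup.mem_top _)
    have h2 := hG.powerful h1
    rw [if_neg hp] at h2
    refine Subgroup.topologicalClosure_minimal _ ?_ (hclosed 0) h2
    rw [Subgroup.closure_le]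
    rintro _ ⟨y, rfl⟩
    exact hpow 0 y (Subgroup.mem_top y)
  | succ i ih =>
    have hnormal : (Subgroup.closure {y : G | ∃ x ∈ lowerPSeries G p (i + 1), y = x ^ p} ⊔
        lowerPSeries G p (i + 3)).Normal := by
      have := closure_pow_normal (p := p) (lowerPSeries G p (i + 1))
      infer_instance
    refine lowerPSeries_succ_le (hclosed _) (hpow _) fun x hx => ?_
    rw [← mem_centralModulo]
    revert x hx
    change lowerPSeries G p (i + 1) ≤ _
    refine ih.trans (sup_le ?_ ?_)
    -- It suffices to treat `[y^p, g]`. With `c = [g, y]`, conjugation turns it, up to inversion,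
    -- into `(c y)^p y^{-p}`, which is `c^p` modulo `P_{i+3}`; and `c` lies in `P_{i+1}`.
    · rw [Subgroup.closure_le]
      rintro _ ⟨y, hy, rfl⟩
      refine mem_centralModulo.mpr fun g => commutator_pow_mem ?_
      have hc := inv_mem (commutator_mem_lowerPSeries hy g)
      rw [commutatorElement_inv] at hc
      have h1 : g * y * g⁻¹ = ⁅g, y⁆ * y := by simp [commutatorElement_def]
      rw [h1]
      generalize ⁅g, y⁆ = c at hc
      have hd : ⁅y⁻¹, c⁻¹⁆ ∈ lowerPSeries G p (i + 2) := by
        rw [← commutatorElement_inv]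
        exact inv_mem (commutator_mem_lowerPSeries (inv_mem hc) _)
      have h2 : (((c * y) ^ p : G) : G ⧸ lowerPSeries G p (i + 3)) = ((c ^ p * y ^ p : G) : G ⧸ _) := by
        refine mk_mul_pow_eq (commutator_mem_lowerPSeries hd _) (commutator_mem_lowerPSeries hd _) ?_
        obtain ⟨m, hm⟩ := hpp.dvd_choose_self two_ne_zero (lt_of_le_of_ne hpp.two_le (Ne.symm hp))
        rw [hm, pow_mul]
        exact pow_mem (pow_mem_lowerPSeries hd) m
      have h3 : (c ^ p)⁻¹ * ((c * y) ^ p * (y ^ p)⁻¹) ∈ lowerPSeries G p (i + 3) := by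
        rw [← QuotientGroup.eq_one_iff, QuotientGroup.mk_mul, QuotientGroup.mk_mul, h2]
        simp
      have h4 := mul_mem (hpow (i + 1) c hc) (le_sup_right (α := Subgroup G) h3)
      rwa [mul_inv_cancel_left] at h4
    · intro z hz
      exact mem_centralModulo.mpr fun g =>
        le_sup_right (α := Subgroup G) (commutator_mem_lowerPSeries hz g)

/-- If `E` generates `G` modulo the Frattini subgroup, then the `p ^ i`-th powers of the members of
`E` generate the quotients of the lower `p`-series. -/
lemma lowerPSeries_le_closure_pow {E : Set G} (hE : Subgroup.closure E ⊔ lowerPSeries G p 1 = ⊤)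
    (i : ℕ) : lowerPSeries G p i ≤
      Subgroup.closure ((fun e => e ^ p ^ i) '' E) ⊔ lowerPSeries G p (i + 1) := by
  induction i with
  | zero => simp [hE]
  | succ i ih =>
    set D := Subgroup.closure ((fun e => e ^ p ^ (i + 1)) '' E) ⊔ lowerPSeries G p (i + 2) with hD
    have hmul : ∀ x ∈ lowerPSeries G p i, ∀ y ∈ lowerPSeries G p i, x ^ p ∈ D → y ^ p ∈ D →
        (x * y) ^ p ∈ D := by
      intro x hx y hy hxD hyD
      have h := QuotientGroup.eq.mp (hG.mk_mul_pow_prime hx hy).symm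
      have h2 := mul_mem (mul_mem hxD hyD) (le_sup_right (α := Subgroup G) h : _ ∈ D)
      rwa [mul_inv_cancel_left] at h2
    have key : ∀ x ∈ Subgroup.closure ((fun e => e ^ p ^ i) '' E), 
        x ∈ lowerPSeries G p i ∧ x ^ p ∈ D := by
      intro x hx
      induction hx using Subgroup.closure_induction with
      | mem x hx =>
        obtain ⟨e, he, rfl⟩ := hx
        refine ⟨pow_prime_pow_mem_lowerPSeries e i, ?_⟩
        refine le_sup_left (α := Subgroup G) (Subgroup.subset_closure ⟨e, he, ?_⟩)
        simp only [pow_succ, pow_mul]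
      | one => simp [one_mem]
      | mul x y _ _ hx hy => exact ⟨mul_mem hx.1 hy.1, hmul x hx.1 y hy.1 hx.2 hy.2⟩
      | inv x _ hx => exact ⟨inv_mem hx.1, by rw [inv_pow]; exact inv_mem hx.2⟩
    -- A generator `x^p` with `x = y z`, where `y` is a word in the `e^{p^i}` and `z` lies in
    -- `P_{i+1}`, is `y^p z^p` modulo `P_{i+2}`, and `z^p` is absorbed.
    refine (hG.lowerPSeries_succ_le_closure_pow i).trans (sup_le ?_ le_sup_right)
    rw [Subgroup.closure_le]
    rintro _ ⟨x, hx, rfl⟩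
    obtain ⟨y, hy, z, hz, rfl⟩ := Subgroup.mem_sup_of_normal_right.mp (ih hx)
    refine hmul y (key y hy).1 z (lowerPSeries_antitone i.le_succ hz) (key y hy).2 ?_
    exact le_sup_right (α := Subgroup G) (pow_mem_lowerPSeries hz)

lemma closure_sup_lowerPSeries {E : Set G} (hE : Subgroup.closure E ⊔ lowerPSeries G p 1 = ⊤)
    (k : ℕ) : Subgroup.closure E ⊔ lowerPSeries G p k = ⊤ := by
  induction k with
  | zero => simp [lowerPSeries]
  | succ k ih =>
    rw [eq_top_iff, ← ih]
    refine sup_le le_sup_left ((hG.lowerPSeries_le_closure_pow hE k).trans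
      (sup_le_sup_right ?_ _))
    rw [Subgroup.closure_le]
    rintro _ ⟨e, he, rfl⟩
    exact pow_mem (Subgroup.subset_closure he) _

end IsUniformProPGroup

end Uniform

/-! ### Ordered products of powers. -/

section OrderedPow

variable {M N : Type*} [Monoid M] [Monoid N] {d : ℕ}

/-- The ordered product `x 0 ^ n 0 * ⋯ * x (d - 1) ^ n (d - 1)`. -/
def orderedPow (x : Fin d → M) (n : Fin d → ℕ) : M :=
  (List.ofFn fun j => x j ^ n j).prod

lemma map_orderedPow (f : M →* N) (x : Fin d → M) (n : Fin d → ℕ) :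
    f (orderedPow x n) = orderedPow (fun j => f (x j)) n := by
  simp [orderedPow, map_list_prod, List.map_ofFn, Function.comp_def]

lemma orderedPow_zero_right (x : Fin d → M) : orderedPow x 0 = 1 := by
  simp [orderedPow]

lemma orderedPow_succ {d : ℕ} (x : Fin (d + 1) → M) (n : Fin (d + 1) → ℕ) :
    orderedPow x n = x 0 ^ n 0 * orderedPow (fun j => x j.succ) (fun j => n j.succ) := by
  simp [orderedPow]

lemma orderedPow_mul_pow {d : ℕ} (x : Fin d → M) (n : Fin d → ℕ) (j : Fin d) (a : ℕ)
    (h : ∀ i, Commute (x j ^ a) (x i)) :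
    orderedPow x n * x j ^ a = orderedPow x (n + Pi.single j a) := by
  induction d with
  | zero => exact j.elim0
  | succ d ih =>
    rw [orderedPow_succ, orderedPow_succ]
    refine Fin.cases (fun h => ?_) (fun j h => ?_) j h
    · have hc : Commute (x 0 ^ a) (orderedPow (fun j => x j.succ) fun j => n j.succ) := by
        refine Commute.list_prod_right _ _ fun y hy => ?_
        rw [List.mem_ofFn] at hy
        obtain ⟨i, rfl⟩ := hy
        exact (h _).pow_right _
      have h0 : (fun i : Fin d => (n + Pi.single (0 : Fin (d + 1)) a : Fin (d + 1) → ℕ) i.succ) = fun i => n i.succ := by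
        ext i; simp
      rw [h0, mul_assoc, ← hc.eq, ← mul_assoc, ← pow_add]
      simp
    · have h0 : (fun i : Fin d => (n + Pi.single j.succ a : Fin (d + 1) → ℕ) i.succ) =
          (fun i => n i.succ) + Pi.single j a := by
        ext i
        simp [Pi.single_apply]
      rw [mul_assoc, ih (fun i => x i.succ) (fun i => n i.succ) j (fun i => h _), h0]
      simp

lemma orderedPow_eq_pow {d : ℕ} (x : Fin d → M) (n : Fin d → ℕ) (j : Fin d)
    (h : ∀ i, i ≠ j → x i = 1) : orderedPow x n = x j ^ n j := by
  induction d with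
  | zero => exact j.elim0
  | succ d ih =>
    rw [orderedPow_succ]
    refine Fin.cases (fun h => ?_) (fun j h => ?_) j h
    · have : (List.ofFn fun i : Fin d => x i.succ ^ n i.succ).prod = 1 := by
        refine List.prod_eq_one fun y hy => ?_
        rw [List.mem_ofFn] at hy
        obtain ⟨i, rfl⟩ := hy
        simp [h i.succ (Fin.succ_ne_zero i)]
      simp [orderedPow, this]
    · rw [ih (fun i => x i.succ) (fun i => n i.succ) j fun i hi => h _ (by simpa using hi),
        h 0 (Fin.succ_ne_zero j).symm]
      simp

lemma orderedPow_congr {x : Fin d → M} {q : ℕ} (hx : ∀ j, x j ^ q = 1) {n n' : Fin d → ℕ}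
    (h : ∀ j, n j ≡ n' j [MOD q]) : orderedPow x n = orderedPow x n' := by
  have : ∀ j, x j ^ n j = x j ^ n' j := fun j => by
    rw [← pow_mod_orderOf, ← pow_mod_orderOf (x j) (n' j)]
    rw [(h j).of_dvd (orderOf_dvd_of_pow_eq_one (hx j))]
  simp [orderedPow, this]

end OrderedPow

lemma IsPGroup.exists_mem_center_orderOf_eq {p : ℕ} [Fact p.Prime] {Q : Type*} [Group Q] [Finite Q]
    [Nontrivial Q] (hQ : IsPGroup p Q) : ∃ z ∈ Subgroup.center Q, orderOf z = p := by
  have hn := hQ.center_nontrivial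
  have hc : IsPGroup p (Subgroup.center Q) := hQ.to_subgroup _
  obtain ⟨n, hn0, hn⟩ := hc.nontrivial_iff_card.mp hn
  obtain ⟨z, hz⟩ := exists_prime_orderOf_dvd_card' (G := Subgroup.center Q) p
    (hn ▸ dvd_pow_self p hn0.ne')
  exact ⟨z, z.2, by rw [Subgroup.orderOf_coe, hz]⟩

/-! ### The lower `p`-series is cofinal among the open normal subgroups. -/

section Cofinal

open scoped commutatorElement

variable {G : Type*} [Group G] [TopologicalSpace G] [IsTopologicalGroup G] {p : ℕ} [Fact p.Prime]

/-- Induction on the index: enlarge `N` to `N'` by a central subgroup of order `p` of `G/N`. If `P_k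
≤ N'`, then `p`-th powers and commutators of elements of `P_k` die in `G/N`, so `P_{k+1} ≤ N`. -/
lemma IsProPGroup.exists_lowerPSeries_le (hG : IsProPGroup p G) (N : OpenNormalSubgroup G) :
    ∃ k, lowerPSeries G p k ≤ (N : Subgroup G) := by
  induction hm : (N : Subgroup G).index using Nat.strong_induction_on generalizing N with
  | _ m ih =>
    obtain ⟨e, he⟩ := hG.index N
    have hpp : p.Prime := Fact.out
    have : (N : Subgroup G).FiniteIndex := ⟨by rw [he]; exact pow_ne_zero _ hpp.ne_zero⟩
    have hQ : IsPGroup p (G ⧸ (N : Subgroup G)) := IsPGroup.of_card (n := e) he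
    rcases subsingleton_or_nontrivial (G ⧸ (N : Subgroup G)) with hs | hn
    · refine ⟨0, fun x _ => ?_⟩
      rw [← QuotientGroup.eq_one_iff]
      exact Subsingleton.elim _ _
    obtain ⟨z, hz, hzp⟩ := hQ.exists_mem_center_orderOf_eq
    have hnorm : (Subgroup.zpowers z).Normal := by
      constructor
      intro x hx y
      have hxc : x ∈ Subgroup.center _ := (Subgroup.zpowers_le.mpr hz) hx
      rw [Subgroup.mem_center_iff.mp hxc y, mul_inv_cancel_right]
      exact hx
    have hle : (N : Subgroup G) ≤ (Subgroup.zpowers z).comap (QuotientGroup.mk' (N : Subgroup G)) := by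
      intro x hx
      rw [Subgroup.mem_comap, QuotientGroup.mk'_apply, (QuotientGroup.eq_one_iff x).mpr hx]
      exact one_mem _
    have hopen := Subgroup.isOpen_mono hle N.isOpen'
    let N' : OpenNormalSubgroup G :=
      { toSubgroup := (Subgroup.zpowers z).comap (QuotientGroup.mk' (N : Subgroup G))
        isOpen' := hopen
        isNormal' := hnorm.comap _ }
    have hlt : (N' : Subgroup G).index < (N : Subgroup G).index := by
      refine Subgroup.index_strictAnti (lt_of_le_of_ne hle fun heq => ?_)
      obtain ⟨x, rfl⟩ := QuotientGroup.mk_surjective z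
      have hx : x ∈ (N : Subgroup G) := by
        rw [heq]
        exact Subgroup.mem_zpowers (x : G ⧸ (N : Subgroup G))
      rw [(QuotientGroup.eq_one_iff x).mpr hx, orderOf_one] at hzp
      exact hpp.one_lt.ne hzp
    obtain ⟨k, hk⟩ := ih _ (hm ▸ hlt) N' rfl
    refine ⟨k + 1, lowerPSeries_succ_le (Subgroup.isClosed_of_isOpen _ N.isOpen') ?_ ?_⟩
    · intro x hx
      obtain ⟨i, hi⟩ := Subgroup.mem_zpowers_iff.mp (hk hx)
      rw [← QuotientGroup.eq_one_iff, QuotientGroup.mk_pow, ← QuotientGroup.mk'_apply, ← hi,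
        ← zpow_natCast, zpow_comm, zpow_natCast, ← hzp, pow_orderOf_eq_one, one_zpow]
    · intro x hx g
      have hxc := (Subgroup.zpowers_le.mpr hz) (hk hx)
      rw [← commute_mk_iff]
      exact (Subgroup.mem_center_iff.mp hxc _).symm

end Cofinal

/-! ### Coordinates on the quotients `G/P_k`. -/

namespace IsUniformProPGroup

open scoped commutatorElement

variable {G : Type*} [Group G] [TopologicalSpace G] [IsTopologicalGroup G] {p : ℕ} [Fact p.Prime]
  (hG : IsUniformProPGroup p G)

/-- The terms of the lower `p`-series as open normal subgroups. -/
def openLowerPSeries (k : ℕ) : OpenNormalSubgroup G where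
  toSubgroup := lowerPSeries G p k
  isOpen' := hG.isOpen_lowerPSeries k
  isNormal' := lowerPSeries_normal k

include hG

/-- `P_1` behaves as a Frattini subgroup: generation modulo `P_1` gives generation modulo every
`P_k`, and the `P_k` form a basis of neighbourhoods of 1. -/
lemma topologicallyGenerates_of_closure_sup {E : Set G}
    (hE : Subgroup.closure E ⊔ lowerPSeries G p 1 = ⊤) : TopologicallyGenerates E := by
  have := hG.compact
  have := hG.totallyDisconnected
  rw [TopologicallyGenerates, Set.eq_univ_iff_forall]
  intro x
  rw [mem_closure_iff]
  intro o ho hx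
  obtain ⟨N, hN⟩ := ProfiniteGrp.exist_openNormalSubgroup_sub_open_nhds_of_one
    (ho.preimage (continuous_const_mul x)) (by simpa using hx)
  obtain ⟨k, hk⟩ := hG.toIsProPGroup.exists_lowerPSeries_le N
  have hxk : x ∈ Subgroup.closure E ⊔ lowerPSeries G p k := by
    rw [hG.closure_sup_lowerPSeries hE k]; exact Subgroup.mem_top x
  obtain ⟨y, hy, z, hz, rfl⟩ := Subgroup.mem_sup_of_normal_right.mp hxk
  refine ⟨y, ?_, hy⟩
  simpa using hN (hk (inv_mem hz))

lemma closure_sup_eq_top {E : Set G} (hE : TopologicallyGenerates E) :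
    Subgroup.closure E ⊔ lowerPSeries G p 1 = ⊤ := by
  have hcl := isClosed_of_isOpen_le (hG.isOpen_lowerPSeries 1)
    (le_sup_right : _ ≤ Subgroup.closure E ⊔ lowerPSeries G p 1)
  rw [eq_top_iff]
  intro x _
  refine closure_minimal (le_sup_left (α := Subgroup G)) hcl ?_
  rw [hE]
  exact Set.mem_univ x

variable {d : ℕ} {g : Fin d → G}

omit hG [Fact p.Prime] in
lemma mk_pow_prime_pow (x : G) (k : ℕ) : (x : G ⧸ lowerPSeries G p k) ^ p ^ k = 1 := by
  rw [← QuotientGroup.mk_pow, QuotientGroup.eq_one_iff]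
  exact pow_prime_pow_mem_lowerPSeries x k

/-- A representation modulo `P_k` is corrected modulo `P_{k+1}` by a word in the `g_j^{p^k}`. These
are central modulo `P_{k+1}`, so each merges into its own slot of the ordered product. -/
lemma exists_mk_orderedPow (hg : TopologicallyGenerates (Set.range g)) (k : ℕ)
    (x : G ⧸ lowerPSeries G p k) : ∃ n, ((orderedPow g n : G) : G ⧸ lowerPSeries G p k) = x := by
  have hpp : p.Prime := Fact.out
  have hE := hG.closure_sup_eq_top hg
  induction k with
  | zero =>
    refine ⟨0, ?_⟩
    induction x using QuotientGroup.induction_on with | _ x =>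
    rw [QuotientGroup.eq]
    exact Subgroup.mem_top _
  | succ k ih =>
    induction x using QuotientGroup.induction_on with | _ x =>
    obtain ⟨n, hn⟩ := ih (x : G ⧸ lowerPSeries G p k)
    rw [QuotientGroup.eq] at hn
    obtain ⟨u, hu, v, hv, huv⟩ :=
      Subgroup.mem_sup_of_normal_right.mp (hG.lowerPSeries_le_closure_pow hE k hn)
    have hS : ∀ u ∈ Subgroup.closure ((fun e => e ^ p ^ k) '' Set.range g), ∀ n, ∃ n',
        ((orderedPow g n * u : G) : G ⧸ lowerPSeries G p (k + 1)) = orderedPow g n' := by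
      intro u hu
      induction hu using Subgroup.closure_induction with
      | mem u hu =>
        obtain ⟨_, ⟨j, rfl⟩, rfl⟩ := hu
        intro n
        refine ⟨n + Pi.single j (p ^ k), ?_⟩
        rw [QuotientGroup.mk_mul, ← QuotientGroup.mk'_apply, ← QuotientGroup.mk'_apply,
          map_orderedPow, map_pow, ← QuotientGroup.mk'_apply, map_orderedPow]
        refine orderedPow_mul_pow (fun j => QuotientGroup.mk' (lowerPSeries G p (k + 1)) (g j)) n j
          (p ^ k) fun i => ?_
        rw [← map_pow]
        exact commute_mk_iff.mpr
          (commutator_mem_lowerPSeries (pow_prime_pow_mem_lowerPSeries (g j) k) (g i))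
      | one => exact fun n => ⟨n, by simp⟩
      | mul u v _ _ hu hv =>
        intro n
        obtain ⟨n', hn'⟩ := hu n
        obtain ⟨n'', hn''⟩ := hv n'
        refine ⟨n'', ?_⟩
        rw [← mul_assoc, QuotientGroup.mk_mul, hn', ← QuotientGroup.mk_mul, hn'']
      | inv u _ hu =>
        have hpow : ∀ (m : ℕ) n, ∃ n',
            ((orderedPow g n * u ^ m : G) : G ⧸ lowerPSeries G p (k + 1)) = orderedPow g n' := by
          intro m
          induction m with
          | zero => exact fun n => ⟨n, by simp⟩
          | succ m ihm =>
            intro n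
            obtain ⟨n', hn'⟩ := ihm n
            obtain ⟨n'', hn''⟩ := hu n'
            refine ⟨n'', ?_⟩
            rw [pow_succ, ← mul_assoc, QuotientGroup.mk_mul, hn', ← QuotientGroup.mk_mul, hn'']
        intro n
        -- Exponents are natural numbers, so `u⁻¹` is replaced by `u^{p^{k+1} - 1}`.
        obtain ⟨n', hn'⟩ := hpow (p ^ (k + 1) - 1) n
        refine ⟨n', ?_⟩
        rw [← hn', QuotientGroup.mk_mul, QuotientGroup.mk_mul, QuotientGroup.mk_inv,
          QuotientGroup.mk_pow, mul_right_inj, inv_eq_iff_mul_eq_one, ← pow_succ',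
          Nat.sub_add_cancel (Nat.one_le_pow _ _ hpp.pos), mk_pow_prime_pow]
    obtain ⟨n', hn'⟩ := hS u hu n
    refine ⟨n', ?_⟩
    rw [← hn', QuotientGroup.eq]
    have : (orderedPow g n * u)⁻¹ * x = v := by
      rw [mul_inv_rev, mul_assoc, ← huv, inv_mul_cancel_left]
    rwa [this]

omit hG [Fact p.Prime] in
lemma mk_orderedPow_congr (k : ℕ) {n n' : Fin d → ℕ} (h : ∀ j, n j ≡ n' j [MOD p ^ k]) :
    ((orderedPow g n : G) : G ⧸ lowerPSeries G p k) = orderedPow g n' := by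
  rw [← QuotientGroup.mk'_apply, ← QuotientGroup.mk'_apply, map_orderedPow, map_orderedPow]
  exact orderedPow_congr (fun j => mk_pow_prime_pow (g j) k) h

lemma exists_mk_orderedPow_lt (hg : TopologicallyGenerates (Set.range g)) (k : ℕ)
    (x : G ⧸ lowerPSeries G p k) :
    ∃ n : Fin d → Fin (p ^ k), ((orderedPow g (fun j => n j) : G) : G ⧸ lowerPSeries G p k) = x := by
  obtain ⟨n, rfl⟩ := hG.exists_mk_orderedPow hg k x
  have : 0 < p ^ k := Nat.pow_pos (Fact.out : p.Prime).pos
  exact ⟨fun j => ⟨n j % p ^ k, Nat.mod_lt _ this⟩, mk_orderedPow_congr k fun j => Nat.mod_modEq _ _⟩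

/-- If two exponent vectors below `p` differ at `i`, dividing further by the other generators yields
a nontrivial relation on `g i`, whose order there divides `p`. Thus `g i` is redundant modulo `P_1`,
hence redundant, against minimality. -/
lemma injective_mk_orderedPow_one (hg : IsMinimalGenerators g) :
    Function.Injective fun n : Fin d → Fin p =>
      ((orderedPow g (fun j => n j) : G) : G ⧸ lowerPSeries G p 1) := by
  have hpp : p.Prime := Fact.out
  intro n n' h
  by_contra hne
  obtain ⟨i, hi⟩ := Function.ne_iff.mp hne
  refine hg.minimal i (hG.topologicallyGenerates_of_closure_sup ?_)
  set K := Subgroup.closure (g '' {j | j ≠ i}) ⊔ lowerPSeries G p 1 with hK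
  have hPK : lowerPSeries G p 1 ≤ K := le_sup_right
  have hnorm : K.Normal := by
    constructor
    intro x hx y
    have : y * x * y⁻¹ = ⁅y, x⁆ * x := by simp [commutatorElement_def]
    rw [this, ← commutatorElement_inv]
    exact mul_mem (inv_mem (hPK (commutator_mem_lowerPSeries (i := 0) (Subgroup.mem_top x) y))) hx
  have h1 : ∀ m : Fin d → ℕ, ((orderedPow g m : G) : G ⧸ K) = (g i : G ⧸ K) ^ m i := by
    intro m
    rw [← QuotientGroup.mk'_apply, map_orderedPow]
    refine orderedPow_eq_pow _ m i fun j hj => ?_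
    rw [QuotientGroup.mk'_apply, QuotientGroup.eq_one_iff]
    exact le_sup_left (α := Subgroup G) (Subgroup.subset_closure ⟨j, hj, rfl⟩)
  have h2 : ((orderedPow g (fun j => n j) : G) : G ⧸ K) = orderedPow g (fun j => n' j) := by
    rw [QuotientGroup.eq] at h ⊢
    exact hPK h
  rw [h1, h1] at h2
  have h3 : (g i : G ⧸ K) ^ p = 1 := by
    rw [← QuotientGroup.mk_pow, QuotientGroup.eq_one_iff]
    exact hPK (pow_mem_lowerPSeries (i := 0) (Subgroup.mem_top _))
  have h4 : (g i : G ⧸ K) = 1 := by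
    rcases (Nat.dvd_prime hpp).mp (orderOf_dvd_of_pow_eq_one h3) with h5 | h5
    · exact orderOf_eq_one_iff.mp h5
    · refine absurd (Fin.ext ?_) hi
      exact pow_injOn_Iio_orderOf (by simp [h5]) (by simp [h5]) h2
  rw [QuotientGroup.eq_one_iff] at h4
  rw [eq_top_iff, ← hG.closure_sup_eq_top hg.generates]
  refine sup_le ?_ hPK
  rw [Subgroup.closure_le]
  rintro _ ⟨j, rfl⟩
  by_cases hj : j = i
  · exact hj ▸ h4
  · exact le_sup_left (α := Subgroup G) (Subgroup.subset_closure ⟨j, hj, rfl⟩)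

lemma card_quotient (hg : IsMinimalGenerators g) (k : ℕ) :
    Nat.card (G ⧸ lowerPSeries G p k) = Nat.card (Fin d → Fin (p ^ k)) := by
  have h1 : (lowerPSeries G p 1).index = p ^ d := by
    have hfin := hG.finite_quotient_one
    refine le_antisymm ?_ ?_
    · have := Nat.card_le_card_of_surjective _ (hG.exists_mk_orderedPow_lt hg.generates 1)
      simpa [Subgroup.index] using this
    · have := Nat.card_le_card_of_injective _ (hG.injective_mk_orderedPow_one hg)
      simpa [Subgroup.index] using this
  change (lowerPSeries G p k).index = _
  rw [hG.index_lowerPSeries, h1]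
  simp [← pow_mul, mul_comm]

lemma bijective_mk_orderedPow (hg : IsMinimalGenerators g) (k : ℕ) :
    Function.Bijective fun n : Fin d → Fin (p ^ k) =>
      ((orderedPow g (fun j => n j) : G) : G ⧸ lowerPSeries G p k) := by
  have := hG.finiteIndex_lowerPSeries k
  exact (Nat.bijective_iff_surjective_and_card _).mpr
    ⟨hG.exists_mk_orderedPow_lt hg.generates k, (hG.card_quotient hg k).symm⟩

lemma mk_orderedPow_eq_iff (hg : IsMinimalGenerators g) (k : ℕ) {n n' : Fin d → ℕ} :
    ((orderedPow g n : G) : G ⧸ lowerPSeries G p k) = orderedPow g n' ↔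
      ∀ j, n j ≡ n' j [MOD p ^ k] := by
  refine ⟨fun h => ?_, mk_orderedPow_congr k⟩
  have hpos : 0 < p ^ k := Nat.pow_pos (Fact.out : p.Prime).pos
  let red : (Fin d → ℕ) → Fin d → Fin (p ^ k) := fun n j => ⟨n j % p ^ k, Nat.mod_lt _ hpos⟩
  have hred : ∀ n, ((orderedPow g (fun j => red n j) : G) : G ⧸ lowerPSeries G p k) = orderedPow g n :=
    fun n => mk_orderedPow_congr k fun j => Nat.mod_modEq _ _
  have h2 : red n = red n' := (hG.bijective_mk_orderedPow hg k).injective (by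
    simp only [hred]; exact h)
  intro j
  exact congrArg Fin.val (congrFun h2 j)

end IsUniformProPGroup

/-! ### The filtration of `ℤ[Q]` by powers of `J = augModulo p Q`. -/

section AugmentationFiltration

open MonoidAlgebra Submodule
open scoped commutatorElement

variable (p : ℕ) (Q : Type*) [Group Q]

/-- The `ℤ`-submodule of `ℤ[Q]` spanned by `p` and the elements `[x] - 1`; it consists of the
elements whose augmentation is divisible by `p`. -/
noncomputable def augModulo : Submodule ℤ (MonoidAlgebra ℤ Q) :=
  span ℤ (insert (p : MonoidAlgebra ℤ Q) (Set.range fun x : Q => single x (1 : ℤ) - 1))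

/-- The multiples of `p` by integers in `ℤ[Q]`. -/
noncomputable def primeLine : Submodule ℤ (MonoidAlgebra ℤ Q) :=
  span ℤ {(p : MonoidAlgebra ℤ Q)}

variable {p Q}

lemma natCast_mem_augModulo : (p : MonoidAlgebra ℤ Q) ∈ augModulo p Q :=
  subset_span (Set.mem_insert _ _)

lemma single_sub_one_mem_augModulo (x : Q) : single x (1 : ℤ) - 1 ∈ augModulo p Q :=
  subset_span (Set.mem_insert_of_mem _ ⟨x, rfl⟩)

lemma primeLine_le_augModulo : primeLine p Q ≤ augModulo p Q :=
  span_le.mpr (by simpa using natCast_mem_augModulo)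

lemma mul_primeLine_comm (M : Submodule ℤ (MonoidAlgebra ℤ Q)) :
    M * primeLine p Q = primeLine p Q * M := by
  refine le_antisymm ?_ ?_ <;> rw [Submodule.mul_le]
  · intro a ha b hb
    obtain ⟨c, rfl⟩ := mem_span_singleton.mp hb
    have : a * c • (p : MonoidAlgebra ℤ Q) = (c • (p : MonoidAlgebra ℤ Q)) * a := by
      rw [mul_smul_comm, smul_mul_assoc, (Nat.cast_commute p a).eq]
    rw [this]
    exact mul_mem_mul hb ha
  · intro b hb a ha
    obtain ⟨c, rfl⟩ := mem_span_singleton.mp hb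
    have : a * c • (p : MonoidAlgebra ℤ Q) = (c • (p : MonoidAlgebra ℤ Q)) * a := by
      rw [mul_smul_comm, smul_mul_assoc, (Nat.cast_commute p a).eq]
    rw [← this]
    exact mul_mem_mul ha hb

lemma top_le_one_sup_augModulo : (⊤ : Submodule ℤ (MonoidAlgebra ℤ Q)) ≤ 1 ⊔ augModulo p Q := by
  intro a _
  induction a using MonoidAlgebra.induction_linear with
  | zero => exact zero_mem _
  | add f g hf hg => exact add_mem (hf trivial) (hg trivial)
  | single x r =>
    have : single x r = r • (1 : MonoidAlgebra ℤ Q) + r • (single x (1 : ℤ) - 1) := by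
      rw [← smul_add, add_sub_cancel, smul_single, smul_eq_mul, mul_one]
    rw [this]
    exact add_mem (smul_mem _ _ (mem_sup_left (Submodule.one_le.mp le_rfl)))
      (smul_mem _ _ (mem_sup_right (single_sub_one_mem_augModulo x)))

lemma augModulo_mul_self_le : augModulo p Q * augModulo p Q ≤ augModulo p Q := by
  have hp : ∀ a, (p : MonoidAlgebra ℤ Q) * a ∈ augModulo p Q := by
    intro a
    induction a using MonoidAlgebra.induction_linear with
    | zero => simp
    | add f g hf hg => rw [mul_add]; exact add_mem hf hg
    | single x r =>
      have : (p : MonoidAlgebra ℤ Q) * single x r =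
          r • (p : MonoidAlgebra ℤ Q) + ((p : ℤ) * r) • (single x (1 : ℤ) - 1) := by
        have h1 : single x r = r • single x (1 : ℤ) := by simp
        simp only [h1, zsmul_eq_mul]
        push_cast
        rw [← (Nat.cast_commute p (r : MonoidAlgebra ℤ Q)).eq]
        noncomm_ring
      rw [this]
      exact add_mem (smul_mem _ _ natCast_mem_augModulo)
        (smul_mem _ _ (single_sub_one_mem_augModulo x))
  rw [augModulo, span_mul_span, span_le]
  rintro _ ⟨a, ha, b, hb, rfl⟩
  rcases ha with rfl | ⟨x, rfl⟩
  · exact hp b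
  rcases hb with rfl | ⟨y, rfl⟩
  · simp only [SetLike.mem_coe]
    rw [← (Nat.cast_commute p _).eq]
    exact hp _
  · have : (single x (1 : ℤ) - 1) * (single y 1 - 1) =
        (single (x * y) (1 : ℤ) - 1) - (single x 1 - 1) - (single y (1 : ℤ) - 1) := by
      have h := single_mul_single x y (1 : ℤ) 1
      rw [mul_one] at h
      rw [← h]
      noncomm_ring
    simp only [SetLike.mem_coe]
    rw [this]
    exact sub_mem (sub_mem (single_sub_one_mem_augModulo _) (single_sub_one_mem_augModulo _))
      (single_sub_one_mem_augModulo _)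

/-- Positive powers of `J` are right ideals. The zeroth power is excluded: as a power of submodules
it is `ℤ · 1`. -/
lemma augModulo_pow_succ_mul_top (n : ℕ) : augModulo p Q ^ (n + 1) * ⊤ ≤ augModulo p Q ^ (n + 1) := by
  rw [pow_succ, mul_assoc]
  refine mul_le_mul' le_rfl ?_
  refine (mul_le_mul' (le_refl (augModulo p Q)) (top_le_one_sup_augModulo (p := p))).trans ?_
  rw [Submodule.mul_sup, mul_one]
  exact sup_le le_rfl augModulo_mul_self_le

lemma augModulo_pow_le {n n' : ℕ} (hn : 0 < n) (h : n ≤ n') :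
    augModulo p Q ^ n' ≤ augModulo p Q ^ n := by
  obtain ⟨n, rfl⟩ := Nat.exists_eq_succ_of_ne_zero hn.ne'
  obtain ⟨t, rfl⟩ := Nat.exists_eq_add_of_le h
  rw [pow_add]
  exact (mul_le_mul' le_rfl le_top).trans (augModulo_pow_succ_mul_top n)

variable (p Q) in
/-- The error terms of degree `n` when reordering products of `n` elements `[x] - 1`. -/
noncomputable def reorderError (n : ℕ) : Submodule ℤ (MonoidAlgebra ℤ Q) :=
  primeLine p Q * augModulo p Q ^ (n - 1) ⊔ augModulo p Q ^ (n + 1)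

lemma augModulo_mul_reorderError_le (n : ℕ) :
    augModulo p Q * reorderError p Q n ≤ reorderError p Q (n + 1) := by
  rw [reorderError, reorderError, Submodule.mul_sup, ← pow_succ', ← mul_assoc, mul_primeLine_comm, mul_assoc,
    ← pow_succ']
  -- The exponent `n - 1` truncates at `n = 0`, so that case needs `p ∈ J` instead.
  cases n with
  | zero =>
    refine sup_le ?_ le_sup_right
    refine le_trans ?_ le_sup_right
    rw [pow_two]
    simpa using mul_le_mul' (primeLine_le_augModulo (p := p)) (le_refl (augModulo p Q))
  | succ n => simp

lemma reorderError_two_mul_le (n : ℕ) :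
    reorderError p Q 2 * augModulo p Q ^ n ≤ reorderError p Q (n + 2) := by
  rw [reorderError, reorderError, Submodule.sup_mul, mul_assoc, ← pow_add, ← pow_add]
  refine le_of_eq ?_
  rw [show 2 - 1 + n = n + 2 - 1 by omega, show 2 + 1 + n = n + 2 + 1 by omega]

lemma reorderError_two_mul_top : reorderError p Q 2 * ⊤ ≤ reorderError p Q 2 := by
  rw [reorderError, Submodule.sup_mul, mul_assoc]
  exact sup_le_sup (mul_le_mul' le_rfl (augModulo_pow_succ_mul_top 0)) (augModulo_pow_succ_mul_top 2)

/-- With `y = [x] - 1`: for odd `p` the binomial expansion of `(1 + y)^p - 1` lies in `pJ + J^p`,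
and `p ≥ 3`. For `p = 2` a square would leave `y^2`, only in `J^2`; the fourth power gains one more
degree. -/
lemma single_pow_sub_one_mem [Fact p.Prime] (x : Q) :
    single (x ^ (if p = 2 then 4 else p)) (1 : ℤ) - 1 ∈ reorderError p Q 2 := by
  have hpp : p.Prime := Fact.out
  have hy := single_sub_one_mem_augModulo (p := p) x
  set y := single x (1 : ℤ) - 1 with hy_def
  have hx : single x (1 : ℤ) = 1 + y := by rw [hy_def, add_sub_cancel]
  have hpow : ∀ n : ℕ, single (x ^ n) (1 : ℤ) = (1 + y) ^ n := fun n => by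
    rw [← hx, single_pow, one_pow]
  rw [hpow]
  split_ifs with hp
  · refine mem_sup_right ?_
    have h2 : (2 : MonoidAlgebra ℤ Q) ∈ augModulo p Q := by
      have := natCast_mem_augModulo (p := p) (Q := Q)
      rw [hp] at this ⊢
      exact_mod_cast this
    have h3 : y * (y + 2) ∈ augModulo p Q ^ 2 := by
      rw [pow_two]
      exact mul_mem_mul hy (add_mem hy h2)
    have h4 : (1 + y) ^ 4 - 1 = (y * (y + 2)) * (y * (y + 2)) + 2 * (y * (y + 2)) := by
      noncomm_ring
    rw [h4, pow_succ']
    refine add_mem (mul_mem_mul ?_ h3) (mul_mem_mul h2 h3)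
    have := augModulo_pow_le (p := p) (Q := Q) one_pos one_le_two h3
    rwa [pow_one] at this
  · obtain ⟨r, hr⟩ := (Commute.one_left y).exists_add_pow_prime_eq hpp
    have h3 : (1 + y) ^ p - 1 = p * (y * r) + y ^ p := by
      rw [hr]
      simp only [one_pow, mul_one, mul_assoc]
      abel
    rw [h3]
    refine add_mem (mem_sup_left (mul_mem_mul (mem_span_singleton_self _) ?_)) (mem_sup_right ?_)
    · have := augModulo_pow_succ_mul_top (p := p) (Q := Q) 0
      rw [zero_add, pow_one] at this
      rw [pow_one]
      exact this (mul_mem_mul hy mem_top)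
    · have h3p : 3 ≤ p := by
        have := hpp.two_le
        omega
      exact augModulo_pow_le (by norm_num) h3p (pow_mem_pow _ hy p)

lemma single_sub_one_mem_of_mem_closure [Fact p.Prime] {z : Q}
    (hz : z ∈ Subgroup.closure {z : Q | ∃ w, z = w ^ (if p = 2 then 4 else p)}) :
    single z (1 : ℤ) - 1 ∈ reorderError p Q 2 := by
  induction hz using Subgroup.closure_induction with
  | mem z hz => obtain ⟨w, rfl⟩ := hz; exact single_pow_sub_one_mem w
  | one => rw [← one_def, sub_self]; exact zero_mem _
  | mul x y _ _ hx hy =>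
    have h : single (x * y) (1 : ℤ) - 1 =
        (single x 1 - 1) * single y 1 + (single y (1 : ℤ) - 1) := by
      have h := single_mul_single x y (1 : ℤ) 1
      rw [mul_one] at h
      rw [← h]
      noncomm_ring
    rw [h]
    exact add_mem (reorderError_two_mul_top (mul_mem_mul hx mem_top)) hy
  | inv x _ hx =>
    have h : single x⁻¹ (1 : ℤ) - 1 = -((single x 1 - 1) * single x⁻¹ 1) := by
      have h := single_mul_single x x⁻¹ (1 : ℤ) 1
      rw [mul_one, mul_inv_cancel, ← one_def] at h
      rw [sub_mul, h]
      noncomm_ring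
    rw [h]
    exact neg_mem (reorderError_two_mul_top (mul_mem_mul hx mem_top))

/-- The additive commutator equals `([⁅x, y⁆] - 1)[y x]`, so being powerful becomes commutativity
modulo `pJ + J^3`, one order better than the trivial `J^2`. -/
lemma commutator_sub_one_mem [Fact p.Prime] {x y : Q}
    (h : ⁅x, y⁆ ∈ Subgroup.closure {z : Q | ∃ w, z = w ^ (if p = 2 then 4 else p)}) :
    (single x (1 : ℤ) - 1) * (single y 1 - 1) - (single y 1 - 1) * (single x (1 : ℤ) - 1) ∈
      reorderError p Q 2 := by
  have h1 : (single x (1 : ℤ) - 1) * (single y 1 - 1) - (single y 1 - 1) * (single x (1 : ℤ) - 1) =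
      (single ⁅x, y⁆ 1 - 1) * single (y * x) 1 := by
    have h2 : single ⁅x, y⁆ (1 : ℤ) * single (y * x) 1 = single x 1 * single y 1 := by
      rw [single_mul_single, single_mul_single, commutatorElement_def]
      simp [mul_assoc]
    have h3 : single (y * x) (1 : ℤ) = single y 1 * single x 1 := by simp [single_mul_single]
    rw [sub_mul (single ⁅x, y⁆ (1 : ℤ)), h2, one_mul, h3]
    noncomm_ring
  rw [h1]
  exact reorderError_two_mul_top
    (mul_mem_mul (single_sub_one_mem_of_mem_closure h) mem_top)

end AugmentationFiltration

/-! ### Spanning the powers of `J` by ordered monomials. -/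

section OrderedSpan

open MonoidAlgebra Submodule
open scoped commutatorElement

lemma perm_flatten_ofFn_replicate {d : ℕ} (l : List (Fin d)) :
    l.Perm (List.ofFn fun j => List.replicate (l.count j) j).flatten := by
  rw [List.perm_iff_count]
  intro a
  rw [List.count_flatten, List.map_ofFn, List.sum_ofFn]
  simp [List.count_replicate]

lemma prod_map_flatten_ofFn_replicate {M : Type*} [Monoid M] {d : ℕ} (x : Fin d → M)
    (α : Fin d → ℕ) :
    (((List.ofFn fun j => List.replicate (α j) j).flatten).map x).prod = orderedPow x α := by
  rw [List.map_flatten, List.prod_flatten, List.map_ofFn, List.map_ofFn, orderedPow]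
  congr 2
  ext j
  simp

lemma sum_count_eq_length {d : ℕ} (l : List (Fin d)) : ∑ j, l.count j = l.length := by
  have := (perm_flatten_ofFn_replicate l).length_eq
  rw [List.length_flatten, List.map_ofFn, List.sum_ofFn] at this
  simpa using this.symm

variable {p : ℕ} {Q : Type*} [Group Q] {d : ℕ} {g : Fin d → Q}

/-- Modulo `J^2` the map `x ↦ [x] - 1` is additive, so its values on generators suffice, together
with `p`. -/
lemma augModulo_le_span_sup (hgen : Subgroup.closure (Set.range g) = ⊤) :
    augModulo p Q ≤ span ℤ (Set.range fun j => single (g j) (1 : ℤ) - 1) ⊔ reorderError p Q 1 := by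
  have hm : augModulo p Q * augModulo p Q ≤ span ℤ (Set.range fun j => single (g j) (1 : ℤ) - 1) ⊔
      reorderError p Q 1 := by
    rw [← pow_two]
    exact le_sup_right.trans le_sup_right
  rw [augModulo, span_le]
  rintro y (rfl | ⟨x, rfl⟩)
  · refine mem_sup_right (mem_sup_left ?_)
    rw [Nat.sub_self, pow_zero, mul_one]
    exact mem_span_singleton_self _
  · have hx : x ∈ Subgroup.closure (Set.range g) := hgen ▸ Subgroup.mem_top x
    simp only [SetLike.mem_coe]
    induction hx using Subgroup.closure_induction with
    | mem x hx => obtain ⟨j, rfl⟩ := hx; exact mem_sup_left (subset_span ⟨j, rfl⟩)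
    | one => rw [← one_def, sub_self]; exact zero_mem _
    | mul x y _ _ hx hy =>
      have h : single (x * y) (1 : ℤ) - 1 = (single x 1 - 1) * (single y 1 - 1) +
          (single x (1 : ℤ) - 1) + (single y (1 : ℤ) - 1) := by
        have h := single_mul_single x y (1 : ℤ) 1
        rw [mul_one] at h
        rw [← h]
        noncomm_ring
      rw [h]
      exact add_mem (add_mem (hm (mul_mem_mul (single_sub_one_mem_augModulo x)
        (single_sub_one_mem_augModulo y))) hx) hy
    | inv x _ hx =>
      have h : single x⁻¹ (1 : ℤ) - 1 = -((single x 1 - 1) * (single x⁻¹ 1 - 1)) -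
          (single x (1 : ℤ) - 1) := by
        have h := single_mul_single x x⁻¹ (1 : ℤ) 1
        rw [mul_one, mul_inv_cancel, ← one_def] at h
        rw [sub_mul, mul_sub, h]
        noncomm_ring
      rw [h]
      exact sub_mem (neg_mem (hm (mul_mem_mul (single_sub_one_mem_augModulo x)
        (single_sub_one_mem_augModulo _)))) hx

lemma span_le_augModulo :
    span ℤ (Set.range fun j => single (g j) (1 : ℤ) - 1) ≤ augModulo p Q := by
  rw [span_le]
  rintro _ ⟨j, rfl⟩
  exact single_sub_one_mem_augModulo _

lemma augModulo_pow_le_span_pow_sup (hgen : Subgroup.closure (Set.range g) = ⊤) (n : ℕ) :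
    augModulo p Q ^ n ≤
      span ℤ (Set.range fun j => single (g j) (1 : ℤ) - 1) ^ n ⊔ reorderError p Q n := by
  induction n with
  | zero => exact le_sup_left
  | succ n ih =>
    rw [pow_succ']
    refine (mul_le_mul' (le_refl (augModulo p Q)) ih).trans ?_
    rw [Submodule.mul_sup]
    refine sup_le ?_ ((augModulo_mul_reorderError_le n).trans le_sup_right)
    refine (mul_le_mul' (augModulo_le_span_sup hgen) le_rfl).trans ?_
    rw [Submodule.sup_mul, ← pow_succ']
    refine sup_le_sup_left ?_ _
    refine (mul_le_mul' (le_refl (reorderError p Q 1))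
      (pow_le_pow_left' (span_le_augModulo (p := p)) n)).trans ?_
    rw [reorderError, reorderError, Submodule.sup_mul, mul_assoc, ← pow_add, ← pow_add,
      Nat.sub_self, Nat.zero_add, Nat.add_sub_cancel, show 1 + 1 + n = n + 1 + 1 by omega]

lemma prod_map_mem_augModulo_pow (l : List (Fin d)) :
    (l.map fun j => single (g j) (1 : ℤ) - 1).prod ∈ augModulo p Q ^ l.length := by
  induction l with
  | nil => exact Submodule.one_le.mp le_rfl
  | cons j l ih =>
    rw [List.map_cons, List.prod_cons, List.length_cons, pow_succ']
    exact mul_mem_mul (single_sub_one_mem_augModulo _) ih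

/-- Swapping two adjacent factors costs an element of `pJ + J^3` times the remaining factors; a
permutation is a chain of such swaps. -/
lemma prod_map_sub_prod_map_mem [Fact p.Prime]
    (hcomm : ∀ x y : Q, ⁅x, y⁆ ∈ Subgroup.closure {z : Q | ∃ w, z = w ^ (if p = 2 then 4 else p)})
    {l l' : List (Fin d)} (h : l.Perm l') :
    (l.map fun j => single (g j) (1 : ℤ) - 1).prod - (l'.map fun j => single (g j) (1 : ℤ) - 1).prod ∈
      reorderError p Q l.length := by
  induction h with
  | nil => simp
  | cons j h ih =>
    rw [List.map_cons, List.map_cons, List.prod_cons, List.prod_cons, ← mul_sub, List.length_cons]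
    exact augModulo_mul_reorderError_le _ (mul_mem_mul (single_sub_one_mem_augModulo _) ih)
  | swap i j l =>
    simp only [List.map_cons, List.prod_cons, List.length_cons]
    rw [← mul_assoc, ← mul_assoc, ← sub_mul]
    exact reorderError_two_mul_le _
      (mul_mem_mul (commutator_sub_one_mem (hcomm _ _)) (prod_map_mem_augModulo_pow l))
  | trans h1 h2 ih1 ih2 =>
    rw [← h1.length_eq] at ih2
    simpa using add_mem ih1 ih2

variable (p g) in
/-- The span of the elements `p ^ a * b ^ α` of `ℤ[Q]`, where `b j = [g j] - 1` and `a + |α|`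
satisfies `P`. -/
noncomputable def orderedSpan (P : ℕ → Prop) : Submodule ℤ (MonoidAlgebra ℤ Q) :=
  span ℤ {y | ∃ (a : ℕ) (α : Fin d → ℕ), P (a + ∑ j, α j) ∧
    y = (p : MonoidAlgebra ℤ Q) ^ a * orderedPow (fun j => single (g j) (1 : ℤ) - 1) α}

lemma span_pow_le_orderedSpan_sup [Fact p.Prime]
    (hcomm : ∀ x y : Q, ⁅x, y⁆ ∈ Subgroup.closure {z : Q | ∃ w, z = w ^ (if p = 2 then 4 else p)})
    (n : ℕ) : span ℤ (Set.range fun j => single (g j) (1 : ℤ) - 1) ^ n ≤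
      orderedSpan p g (· = n) ⊔ reorderError p Q n := by
  rw [span_pow, span_le]
  intro y hy
  obtain ⟨f, rfl⟩ := Set.mem_pow.mp hy
  choose j hj using fun i => (f i).2
  simp only [← hj]
  have hl : (List.ofFn fun i => single (g (j i)) (1 : ℤ) - 1) =
      (List.ofFn j).map fun j => single (g j) (1 : ℤ) - 1 := by
    rw [List.map_ofFn]; rfl
  have hlen : (List.ofFn j).length = n := List.length_ofFn
  rw [hl]
  generalize List.ofFn j = l at hlen
  have h := prod_map_sub_prod_map_mem (g := g) hcomm (perm_flatten_ofFn_replicate l)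
  rw [prod_map_flatten_ofFn_replicate, hlen] at h
  simp only [SetLike.mem_coe]
  rw [← sub_add_cancel (List.map _ l).prod (orderedPow _ _)]
  refine add_mem (mem_sup_right h) (mem_sup_left (subset_span ⟨0, fun j => l.count j, ?_, ?_⟩))
  · rw [sum_count_eq_length, zero_add, hlen]
  · rw [pow_zero, one_mul]

lemma primeLine_mul_orderedSpan_le (n : ℕ) :
    primeLine p Q * orderedSpan p g (· = n) ≤ orderedSpan p g (· = n + 1) := by
  rw [primeLine, orderedSpan, span_mul_span, span_le]
  rintro _ ⟨_, rfl, _, ⟨a, α, h, rfl⟩, rfl⟩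
  refine subset_span ⟨a + 1, α, by omega, ?_⟩
  simp only [pow_succ', mul_assoc]

/-- The reordering error in degree `n + 1` is `p J^n + J^{n+2}`. The induction hypothesis applies to
`J^n`, and multiplying ordered terms by `p` raises `a` by one. -/
lemma augModulo_pow_le_orderedSpan_sup [Fact p.Prime]
    (hgen : Subgroup.closure (Set.range g) = ⊤)
    (hcomm : ∀ x y : Q, ⁅x, y⁆ ∈ Subgroup.closure {z : Q | ∃ w, z = w ^ (if p = 2 then 4 else p)})
    (n : ℕ) : augModulo p Q ^ n ≤ orderedSpan p g (· = n) ⊔ augModulo p Q ^ (n + 1) := by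
  induction n with
  | zero =>
    refine le_sup_of_le_left ?_
    rw [pow_zero, Submodule.one_le]
    exact subset_span ⟨0, 0, by simp, by simp [orderedPow_zero_right]⟩
  | succ n ih =>
    refine (augModulo_pow_le_span_pow_sup hgen (n + 1)).trans (sup_le
      ((span_pow_le_orderedSpan_sup hcomm (n + 1)).trans (sup_le le_sup_left ?_)) ?_) <;>
    · refine sup_le ?_ le_sup_right
      rw [Nat.add_sub_cancel]
      refine (mul_le_mul' le_rfl ih).trans ?_
      rw [Submodule.mul_sup]
      refine sup_le_sup (primeLine_mul_orderedSpan_le n) ?_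
      rw [pow_succ' _ (n + 1)]
      exact mul_le_mul' primeLine_le_augModulo le_rfl

lemma augModulo_pow_le_orderedSpan_ge_sup [Fact p.Prime]
    (hgen : Subgroup.closure (Set.range g) = ⊤)
    (hcomm : ∀ x y : Q, ⁅x, y⁆ ∈ Subgroup.closure {z : Q | ∃ w, z = w ^ (if p = 2 then 4 else p)})
    (n t : ℕ) : augModulo p Q ^ n ≤ orderedSpan p g (n ≤ ·) ⊔ augModulo p Q ^ (n + t) := by
  induction t with
  | zero => exact le_sup_right
  | succ t ih =>
    refine ih.trans (sup_le le_sup_left ?_)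
    refine (augModulo_pow_le_orderedSpan_sup hgen hcomm (n + t)).trans (sup_le_sup_right ?_ _)
    refine span_mono ?_
    rintro _ ⟨a, α, h, rfl⟩
    exact ⟨a, α, by omega, rfl⟩

end OrderedSpan

/-! ### Powers of `J` are `p`-adically small for a finite `p`-group. -/

section Nilpotent

open MonoidAlgebra Submodule

lemma augModulo_map_le {p : ℕ} {Q Q' : Type*} [Group Q] [Group Q'] (f : Q →* Q') :
    (augModulo p Q).map (mapDomainRingHom ℤ f).toIntAlgHom.toLinearMap ≤ augModulo p Q' := by
  rw [augModulo, map_span, span_le]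
  rintro _ ⟨_, (rfl | ⟨x, rfl⟩), rfl⟩
  · simpa using natCast_mem_augModulo
  · have h : mapDomainRingHom ℤ f (single x (1 : ℤ) - 1) = single (f x) 1 - 1 := by
      rw [map_sub, map_one, mapDomainRingHom_apply, mapDomain_single]
    change mapDomainRingHom ℤ f (single x (1 : ℤ) - 1) ∈ augModulo p Q'
    rw [h]
    exact single_sub_one_mem_augModulo (f x)

lemma mem_primeLine_mul_top {p : ℕ} {Q : Type*} [Group Q] {a : MonoidAlgebra ℤ Q} :
    a ∈ primeLine p Q * ⊤ ↔ ∃ u, a = (p : MonoidAlgebra ℤ Q) * u := by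
  constructor
  · intro ha
    induction ha using Submodule.mul_induction_on' with
    | mem_mul_mem m hm n _ =>
      obtain ⟨c, rfl⟩ := mem_span_singleton.mp hm
      exact ⟨c • n, by rw [smul_mul_assoc, mul_smul_comm]⟩
    | add x _ y _ hx hy =>
      obtain ⟨u, rfl⟩ := hx
      obtain ⟨v, rfl⟩ := hy
      exact ⟨u + v, (mul_add _ _ _).symm⟩
  · rintro ⟨u, rfl⟩
    exact mul_mem_mul (mem_span_singleton_self _) mem_top

/-- A power of the augmentation ideal of a finite `p`-group consists of multiples of `p`. -/
lemma IsPGroup.exists_augModulo_pow_le {p : ℕ} [Fact p.Prime] {Q : Type*} [Group Q] [Finite Q]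
    (hQ : IsPGroup p Q) : ∃ T, 0 < T ∧ augModulo p Q ^ T ≤ primeLine p Q * ⊤ := by
  have hpp : p.Prime := Fact.out
  induction hm : Nat.card Q using Nat.strong_induction_on generalizing Q with
  | _ m ih =>
    rcases subsingleton_or_nontrivial Q with hs | hn
    · refine ⟨1, one_pos, ?_⟩
      rw [pow_one, augModulo, span_le]
      rintro _ (rfl | ⟨x, rfl⟩)
      · exact mem_primeLine_mul_top.mpr ⟨1, (mul_one _).symm⟩
      · simp only [SetLike.mem_coe]
        rw [Subsingleton.elim x 1, ← one_def, sub_self]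
        exact zero_mem _
    obtain ⟨z, hz, hzp⟩ := hQ.exists_mem_center_orderOf_eq
    have hzc : ∀ x, x * z = z * x := Subgroup.mem_center_iff.mp hz
    have hnorm : (Subgroup.zpowers z).Normal := by
      constructor
      intro x hx y
      have hxc : x ∈ Subgroup.center _ := (Subgroup.zpowers_le.mpr hz) hx
      rw [Subgroup.mem_center_iff.mp hxc y, mul_inv_cancel_right]
      exact hx
    set Q' := Q ⧸ Subgroup.zpowers z
    have hcard : Nat.card Q' < Nat.card Q := by
      rw [Subgroup.card_eq_card_quotient_mul_card_subgroup (Subgroup.zpowers z), Nat.card_zpowers,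
        hzp]
      exact lt_mul_of_one_lt_right Nat.card_pos hpp.one_lt
    obtain ⟨T, hT, hle⟩ := ih _ (hm ▸ hcard) (hQ.to_quotient (Subgroup.zpowers z)) rfl
    -- Modulo `p`, `J^T` lies in the ideal of the central element `[z] - 1` by induction on `Q/⟨z⟩`,
    -- and the `p`-th power of that element is divisible by `p` because `z^p = 1`.
    refine ⟨T * p, Nat.mul_pos hT hpp.pos, ?_⟩
    set Z : Submodule ℤ (MonoidAlgebra ℤ Q) := span ℤ {single z (1 : ℤ) - 1} with hZ
    have hZc : ∀ a : MonoidAlgebra ℤ Q, a * (single z (1 : ℤ) - 1) = (single z 1 - 1) * a := by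
      intro a
      induction a using MonoidAlgebra.induction_linear with
      | zero => simp
      | add f g hf hg => rw [add_mul, mul_add, hf, hg]
      | single x r => simp [mul_sub, sub_mul, single_mul_single, hzc]
    let s : Q' → Q := Quotient.out
    let lift : MonoidAlgebra ℤ Q' →+ MonoidAlgebra ℤ Q :=
      { toFun := mapDomain s, map_zero' := mapDomain_zero s, map_add' := mapDomain_add s }
    set f := mapDomainRingHom ℤ (QuotientGroup.mk' (Subgroup.zpowers z)) with hf
    -- The kernel of `ℤ[Q] → ℤ[Q/⟨z⟩]` is generated by `[z] - 1`: each `x` is its chosen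
    -- representative times `z^i`, and `[z]^i - 1` is divisible by `[z] - 1` as a geometric sum.
    have hlift : ∀ a : MonoidAlgebra ℤ Q, a - lift (f a) ∈ Z * ⊤ := by
      intro a
      induction a using MonoidAlgebra.induction_linear with
      | zero => simp
      | add a b ha hb =>
        rw [map_add, map_add, add_sub_add_comm]
        exact add_mem ha hb
      | single x r =>
        have hw : (s (x : Q'))⁻¹ * x ∈ Subgroup.zpowers z :=
          QuotientGroup.eq.mp (Quotient.out_eq (x : Q'))
        obtain ⟨i, hi⟩ := mem_powers_iff_mem_zpowers.mpr hw
        have hlx : lift (f (single x r)) = single (s (x : Q')) r := by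
          change mapDomain s (mapDomain _ (single x r)) = _
          rw [mapDomain_single, mapDomain_single]
          rfl
        have hx : single x r = single (s (x : Q')) r * single z 1 ^ i := by
          rw [single_pow, single_mul_single, one_pow, mul_one, show z ^ i = _ from hi,
            mul_inv_cancel_left]
        rw [hlx, hx, ← mul_sub_one, ← mul_geom_sum, ← mul_assoc, hZc, mul_assoc]
        exact mul_mem_mul (mem_span_singleton_self _) mem_top
    have h1 : augModulo p Q ^ T ≤ Z * ⊤ ⊔ primeLine p Q * ⊤ := by
      intro a ha
      have hfa : f a ∈ augModulo p Q' ^ T := by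
        have h := Submodule.mem_map_of_mem (f := f.toIntAlgHom.toLinearMap) ha
        rw [Submodule.map_pow] at h
        exact pow_le_pow_left' (augModulo_map_le _) T h
      obtain ⟨u, hu⟩ := mem_primeLine_mul_top.mp (hle hfa)
      rw [← sub_add_cancel a (lift (f a))]
      refine add_mem (mem_sup_left (hlift a)) (mem_sup_right (mem_primeLine_mul_top.mpr
        ⟨lift u, ?_⟩))
      rw [hu, ← nsmul_eq_mul, ← nsmul_eq_mul, map_nsmul]
    have h2 : Z ^ p ≤ primeLine p Q * ⊤ := by
      rw [hZ, span_pow, Set.singleton_pow, span_singleton_le_iff_mem, mem_primeLine_mul_top]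
      obtain ⟨r, hr⟩ := (Commute.one_left (single z (1 : ℤ) - 1)).exists_add_pow_prime_eq hpp
      rw [add_sub_cancel, single_pow, one_pow, one_pow, ← hzp, pow_orderOf_eq_one, ← one_def,
        add_assoc, left_eq_add, hzp] at hr
      refine ⟨-((single z (1 : ℤ) - 1) * r), ?_⟩
      rw [mul_neg, eq_neg_iff_add_eq_zero, ← hr, mul_one, mul_assoc]
    have hZtop : Commute (⊤ : Submodule ℤ (MonoidAlgebra ℤ Q)) Z := by
      refine le_antisymm ?_ ?_ <;> rw [Submodule.mul_le]
      · intro a _ b hb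
        obtain ⟨c, rfl⟩ := mem_span_singleton.mp hb
        rw [mul_smul_comm, hZc, ← smul_mul_assoc]
        exact mul_mem_mul hb mem_top
      · intro b hb a _
        obtain ⟨c, rfl⟩ := mem_span_singleton.mp hb
        rw [smul_mul_assoc, ← hZc, ← mul_smul_comm]
        exact mul_mem_mul mem_top hb
    have h3 : ∀ k, (Z * ⊤ ⊔ primeLine p Q * ⊤) ^ k ≤ Z ^ k * ⊤ ⊔ primeLine p Q * ⊤ := by
      intro k
      induction k with
      | zero => simp
      | succ k ihk =>
        rw [pow_succ]
        refine (mul_le_mul' ihk le_rfl).trans ?_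
        rw [Submodule.sup_mul, Submodule.mul_sup, Submodule.mul_sup]
        refine sup_le (sup_le (le_sup_of_le_left ?_) (le_sup_of_le_right ?_))
          (le_sup_of_le_right (sup_le ?_ ?_))
        · rw [mul_assoc, ← mul_assoc ⊤ Z, hZtop.eq, pow_succ, mul_assoc, mul_assoc]
          exact mul_le_mul' le_rfl (mul_le_mul' le_rfl le_top)
        · rw [← mul_assoc, mul_primeLine_comm, mul_assoc]
          exact mul_le_mul' le_rfl le_top
        · rw [mul_assoc]
          exact mul_le_mul' le_rfl le_top
        · rw [mul_assoc]
          exact mul_le_mul' le_rfl le_top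
    rw [pow_mul]
    refine (pow_le_pow_left' h1 p).trans ((h3 p).trans (sup_le ?_ le_rfl))
    refine (mul_le_mul' h2 le_rfl).trans ?_
    rw [mul_assoc]
    exact mul_le_mul' le_rfl le_top

lemma IsPGroup.exists_mem_augModulo_pow_imp {p : ℕ} [Fact p.Prime] {Q : Type*} [Group Q] [Finite Q]
    (hQ : IsPGroup p Q) (e : ℕ) :
    ∃ T, ∀ n, ∀ a ∈ augModulo p Q ^ (n + T), ∃ u, a = (p : MonoidAlgebra ℤ Q) ^ e * u := by
  obtain ⟨T, hT, hle⟩ := hQ.exists_augModulo_pow_le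
  have h : (augModulo p Q ^ T) ^ e ≤ primeLine p Q ^ e * ⊤ := by
    refine (pow_le_pow_left' hle e).trans ?_
    induction e with
    | zero => simp
    | succ e ih =>
      rw [pow_succ]
      refine (mul_le_mul' ih le_rfl).trans ?_
      rw [mul_assoc, ← mul_assoc ⊤, mul_primeLine_comm, pow_succ, mul_assoc, mul_assoc]
      exact mul_le_mul' le_rfl (mul_le_mul' le_rfl le_top)
  refine ⟨T * e, fun n a ha => ?_⟩
  rw [pow_add, pow_mul] at ha
  have hcomm : Commute (⊤ : Submodule ℤ (MonoidAlgebra ℤ Q)) (primeLine p Q ^ e) :=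
    Commute.pow_right (show Commute ⊤ (primeLine p Q) from mul_primeLine_comm (p := p) ⊤) e
  have := mul_le_mul' (le_top : augModulo p Q ^ n ≤ ⊤) h ha
  rw [← mul_assoc, hcomm.eq, mul_assoc] at this
  replace this := mul_le_mul' (le_refl (primeLine p Q ^ e)) le_top this
  rw [primeLine, span_pow, Set.singleton_pow, ← Nat.cast_pow] at this
  obtain ⟨u, hu⟩ := mem_primeLine_mul_top.mp this
  exact ⟨u, by rw [hu, Nat.cast_pow]⟩

end Nilpotent

/-! ### Binomial expansion of ordered products, and congruences for binomial coefficients. -/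

section OrderedExpansion

lemma prod_ofFn_sum {A : Type*} [Semiring A] {d : ℕ} (s : Finset ℕ) (F : Fin d → ℕ → A) :
    (List.ofFn fun j => ∑ i ∈ s, F j i).prod =
      ∑ β ∈ Fintype.piFinset fun _ : Fin d => s, (List.ofFn fun j => F j (β j)).prod := by
  induction d with
  | zero => simp
  | succ d ih =>
    rw [List.ofFn_succ, List.prod_cons, ih, Finset.sum_mul_sum, ← Finset.sum_product']
    refine Finset.sum_nbij' (fun x => Fin.cons x.1 x.2) (fun β => (β 0, Fin.tail β)) ?_ ?_ ?_ ?_ ?_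
    · rintro ⟨i, β⟩ h
      simp only [Finset.mem_product, Fintype.mem_piFinset] at h ⊢
      exact Fin.cases h.1 h.2
    · intro β h
      simp only [Finset.mem_product, Fintype.mem_piFinset] at h ⊢
      exact ⟨h 0, fun j => h j.succ⟩
    · intro x _; simp
    · intro β _; simp
    · rintro ⟨i, β⟩ _; simp

/-- The product of the binomial coefficients of the entries. -/
def multiChoose {d : ℕ} (n α : Fin d → ℕ) : ℕ := ∏ j, (n j).choose (α j)

lemma multiChoose_self {d : ℕ} (n : Fin d → ℕ) : multiChoose n n = 1 := by
  simp [multiChoose]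

lemma multiChoose_eq_zero {d : ℕ} {n α : Fin d → ℕ} (h : ¬ α ≤ n) : multiChoose n α = 0 := by
  rw [Pi.le_def, not_forall] at h
  obtain ⟨j, hj⟩ := h
  exact Finset.prod_eq_zero (Finset.mem_univ j) (Nat.choose_eq_zero_of_lt (not_le.mp hj))

lemma one_add_pow_eq_sum {A : Type*} [Semiring A] (b : A) {n N : ℕ} (h : n < N) :
    (1 + b) ^ n = ∑ i ∈ Finset.range N, (n.choose i : A) * b ^ i := by
  rw [add_comm, (Commute.one_right b).add_pow]
  rw [← Finset.sum_subset (Finset.range_mono h) fun i _ hi => ?_]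
  · refine Finset.sum_congr rfl fun i _ => ?_
    rw [one_pow, mul_one, (Nat.cast_commute _ _).eq]
  · rw [Nat.choose_eq_zero_of_lt (by simpa using hi)]
    simp

lemma prod_ofFn_natCast_mul {A : Type*} [Semiring A] {d : ℕ} (c : Fin d → ℕ) (x : Fin d → A) :
    (List.ofFn fun j => (c j : A) * x j).prod = ((∏ j, c j : ℕ) : A) * (List.ofFn x).prod := by
  induction d with
  | zero => simp
  | succ d ih =>
    rw [List.ofFn_succ, List.prod_cons, ih, List.ofFn_succ, List.prod_cons, Fin.prod_univ_succ,
      Nat.cast_mul, mul_assoc, mul_assoc, ← mul_assoc (x 0), ← (Nat.cast_commute _ (x 0)).eq]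
    simp only [mul_assoc]

lemma orderedPow_one_add {A : Type*} [Semiring A] {d : ℕ} (b : Fin d → A) {n : Fin d → ℕ} {N : ℕ}
    (h : ∀ j, n j < N) :
    orderedPow (fun j => 1 + b j) n =
      ∑ β ∈ Fintype.piFinset fun _ : Fin d => Finset.range N,
        (multiChoose n β : A) * orderedPow b β := by
  have : ∀ j, (1 + b j) ^ n j = ∑ i ∈ Finset.range N, ((n j).choose i : A) * b j ^ i :=
    fun j => one_add_pow_eq_sum (b j) (h j)
  rw [orderedPow]
  simp only [this]
  rw [prod_ofFn_sum]
  refine Finset.sum_congr rfl fun β _ => ?_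
  rw [prod_ofFn_natCast_mul, multiChoose, orderedPow]

lemma single_orderedPow_eq_sum {R : Type*} [CommRing R] {H : Type*} [Group H] {d : ℕ} (g : Fin d → H)
    {n : Fin d → ℕ} {N : ℕ} (h : ∀ j, n j < N) :
    MonoidAlgebra.single (orderedPow g n) (1 : R) =
      ∑ β ∈ Fintype.piFinset fun _ : Fin d => Finset.range N, (multiChoose n β : R) •
        orderedPow (fun j => MonoidAlgebra.single (g j) (1 : R) - 1) β := by
  have h1 : MonoidAlgebra.single (orderedPow g n) (1 : R) =
      orderedPow (fun j => MonoidAlgebra.single (g j) (1 : R)) n :=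
    map_orderedPow (MonoidAlgebra.of R H) g n
  rw [h1]
  have h2 := orderedPow_one_add (fun j => MonoidAlgebra.single (g j) (1 : R) - 1) h
  simp only [add_sub_cancel] at h2
  rw [h2]
  refine Finset.sum_congr rfl fun β _ => ?_
  rw [Nat.cast_smul_eq_nsmul R, nsmul_eq_mul]

/-- The loss of `p`-adic precision in the congruences for the function `n ↦ multiChoose n α`. -/
def chooseLoss (p : ℕ) {d : ℕ} (α : Fin d → ℕ) : ℕ := padicValNat p (∏ j, (α j).factorial)

/-- Multiplied by `∏ α_j!`, the binomial coefficients become falling factorials, integral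
polynomials in `n`, which respect congruences modulo `p^k`. Dividing back loses exactly the `p`-part
of the factorials. -/
lemma pow_dvd_multiChoose_sub {p : ℕ} [Fact p.Prime] {d : ℕ} (α : Fin d → ℕ) {k : ℕ}
    {n n' : Fin d → ℕ} (h : ∀ j, n j ≡ n' j [MOD p ^ k]) :
    (p : ℤ) ^ (k - chooseLoss p α) ∣ (multiChoose n α : ℤ) - multiChoose n' α := by
  have hpp : p.Prime := Fact.out
  set F := ∏ j, (α j).factorial with hF
  have hF0 : F ≠ 0 := Finset.prod_ne_zero_iff.mpr fun j _ => Nat.factorial_ne_zero _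
  have hmul : ∀ n : Fin d → ℕ, ((F * multiChoose n α : ℕ) : ℤ) =
      ∏ j, (((n j).descFactorial (α j) : ℕ) : ℤ) := by
    intro n
    rw [hF, multiChoose, ← Finset.prod_mul_distrib, Nat.cast_prod]
    simp only [Nat.descFactorial_eq_factorial_mul_choose]
  have hmod : ∀ j, (((n j).descFactorial (α j) : ℕ) : ℤ) ≡ ((n' j).descFactorial (α j) : ℕ)
      [ZMOD (p ^ k : ℕ)] := by
    intro j
    rw [← descPochhammer_eval_eq_descFactorial, ← descPochhammer_eval_eq_descFactorial]
    refine ((Int.modEq_iff_dvd).mpr ?_).symm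
    exact ((Int.modEq_iff_dvd).mp (Int.natCast_modEq_iff.mpr (h j)).symm).trans
      (Polynomial.sub_dvd_eval_sub _ _ _)
  have hdvd : ((p ^ k : ℕ) : ℤ) ∣ F * ((multiChoose n α : ℤ) - multiChoose n' α) := by
    have h1 := (Int.modEq_iff_dvd).mp (Int.ModEq.prod (s := Finset.univ) fun j _ => hmod j).symm
    rw [← hmul, ← hmul] at h1
    rw [mul_sub]
    exact_mod_cast h1
  obtain ⟨F', hF'⟩ : p ^ chooseLoss p α ∣ F := pow_padicValNat_dvd
  rcases le_total k (chooseLoss p α) with hle | hle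
  · rw [Nat.sub_eq_zero_of_le hle, pow_zero]; exact one_dvd _
  have hcop : ¬ p ∣ F' := by
    rintro ⟨c, rfl⟩
    refine pow_succ_padicValNat_not_dvd (p := p) hF0 ⟨c, ?_⟩
    change F = p ^ (chooseLoss p α + 1) * c
    rw [hF', pow_succ, mul_assoc]
  have h2 : (p : ℤ) ^ (k - chooseLoss p α) ∣ F' * ((multiChoose n α : ℤ) - multiChoose n' α) := by
    have hp0 : ((p : ℤ) ^ chooseLoss p α) ≠ 0 := pow_ne_zero _ (by exact_mod_cast hpp.ne_zero)
    refine (mul_dvd_mul_iff_left hp0).mp ?_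
    rw [← pow_add, Nat.add_sub_cancel' hle, ← mul_assoc]
    have : ((F : ℕ) : ℤ) = (p : ℤ) ^ chooseLoss p α * F' := by rw [hF']; push_cast; rfl
    rw [← this]
    exact_mod_cast hdvd
  refine IsCoprime.dvd_of_dvd_mul_left ?_ h2
  refine IsCoprime.pow_left ?_
  exact Nat.isCoprime_iff_coprime.mpr ((Nat.Prime.coprime_iff_not_dvd hpp).mpr hcop)

end OrderedExpansion

/-! ### Binomial functionals on the group rings of the `G/P_k`. -/

namespace IsUniformProPGroup

open MonoidAlgebra Filter Topology
open scoped commutatorElement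

variable {G : Type*} [Group G] [TopologicalSpace G] [IsTopologicalGroup G] {p : ℕ} [Fact p.Prime]
  (hG : IsUniformProPGroup p G) {d : ℕ} {g : Fin d → G} (hg : IsMinimalGenerators g)

lemma finite_quotient (hG : IsUniformProPGroup p G) (k : ℕ) : Finite (G ⧸ lowerPSeries G p k) :=
  have := hG.finiteIndex_lowerPSeries k
  inferInstance

omit [Fact p.Prime] in
lemma _root_.isPGroup_quotient_lowerPSeries (k : ℕ) : IsPGroup p (G ⧸ lowerPSeries G p k) := by
  intro x
  induction x using QuotientGroup.induction_on with | _ x =>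
  exact ⟨k, mk_pow_prime_pow x k⟩

/-- Powerfulness without topological closure: `P_k` is open, so the abstract power subgroup times
`P_k` is already closed. -/
lemma commutator_quotient_mem (hG : IsUniformProPGroup p G) (k : ℕ)
    (x y : G ⧸ lowerPSeries G p k) : ⁅x, y⁆ ∈ Subgroup.closure
      {z : G ⧸ lowerPSeries G p k | ∃ w, z = w ^ (if p = 2 then 4 else p)} := by
  set q := if p = 2 then 4 else p with hq
  induction x using QuotientGroup.induction_on with | _ x =>
  induction y using QuotientGroup.induction_on with | _ y =>
  have hcl := isClosed_of_isOpen_le (hG.isOpen_lowerPSeries k)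
    (le_sup_right : _ ≤ Subgroup.closure {z : G | ∃ w, z = w ^ q} ⊔ lowerPSeries G p k)
  have h1 : ⁅x, y⁆ ∈ powerSubgroup G q := hG.powerful
    (Subgroup.commutator_mem_commutator (Subgroup.mem_top _) (Subgroup.mem_top _))
  have h2 := Subgroup.topologicalClosure_minimal _ le_sup_left hcl h1
  obtain ⟨u, hu, v, hv, huv⟩ := Subgroup.mem_sup_of_normal_right.mp h2
  have h3 : ⁅(x : G ⧸ lowerPSeries G p k), (y : G ⧸ lowerPSeries G p k)⁆ =
      QuotientGroup.mk' (lowerPSeries G p k) u := by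
    rw [← QuotientGroup.mk'_apply, ← QuotientGroup.mk'_apply, ← map_commutatorElement, ← huv,
      map_mul, QuotientGroup.mk'_apply _ v, (QuotientGroup.eq_one_iff v).mpr hv, mul_one]
  rw [h3]
  have h4 := Subgroup.mem_map_of_mem (QuotientGroup.mk' (lowerPSeries G p k)) hu
  rw [MonoidHom.map_closure] at h4
  refine Subgroup.closure_mono ?_ h4
  rintro _ ⟨_, ⟨w, rfl⟩, rfl⟩
  exact ⟨QuotientGroup.mk' _ w, map_pow _ _ _⟩

include hG hg in
lemma closure_range_mk (k : ℕ) :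
    Subgroup.closure (Set.range fun j => (g j : G ⧸ lowerPSeries G p k)) = ⊤ := by
  rw [eq_top_iff]
  intro x _
  obtain ⟨n, rfl⟩ := hG.exists_mk_orderedPow hg.generates k x
  rw [← QuotientGroup.mk'_apply, map_orderedPow]
  refine list_prod_mem fun y hy => ?_
  rw [List.mem_ofFn] at hy
  obtain ⟨j, rfl⟩ := hy
  exact pow_mem (Subgroup.subset_closure (Set.mem_range_self j)) _

/-- The exponents of the ordered product representing an element of `G` modulo the `k`-th term of
the lower `p`-series. -/
noncomputable def exponent (k : ℕ) (x : G ⧸ lowerPSeries G p k) (j : Fin d) : ℕ :=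
  (hG.exists_mk_orderedPow_lt hg.generates k x).choose j

lemma exponent_lt (k : ℕ) (x : G ⧸ lowerPSeries G p k) (j : Fin d) :
    hG.exponent hg k x j < p ^ k := Fin.is_lt _

lemma mk_orderedPow_exponent (k : ℕ) (x : G ⧸ lowerPSeries G p k) :
    ((orderedPow g (hG.exponent hg k x) : G) : G ⧸ lowerPSeries G p k) = x :=
  (hG.exists_mk_orderedPow_lt hg.generates k x).choose_spec

lemma exponent_modEq (k : ℕ) (n : Fin d → ℕ) (j : Fin d) :
    hG.exponent hg k ((orderedPow g n : G) : G ⧸ lowerPSeries G p k) j ≡ n j [MOD p ^ k] :=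
  (hG.mk_orderedPow_eq_iff hg k).mp (hG.mk_orderedPow_exponent hg k _) j

/-- The functional on the group ring of a quotient by a term of the lower `p`-series which sends
the class of `g ^ n` to the binomial coefficient of `n` and `α`. It approximates the coefficient
of `b ^ α`. -/
noncomputable def chooseFunctional (R : Type*) [CommRing R] (k : ℕ) (α : Fin d → ℕ) :
    MonoidAlgebra R (G ⧸ lowerPSeries G p k) →ₗ[R] R :=
  Finsupp.linearCombination R (fun x => (multiChoose (hG.exponent hg k x) α : R)) ∘ₗ
    (MonoidAlgebra.coeffLinearEquiv R).toLinearMap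

lemma chooseFunctional_single {R : Type*} [CommRing R] (k : ℕ) (α : Fin d → ℕ)
    (x : G ⧸ lowerPSeries G p k) (r : R) :
    hG.chooseFunctional hg R k α (single x r) = r * multiChoose (hG.exponent hg k x) α := by
  change Finsupp.linearCombination R _ (Finsupp.single x r) = _
  rw [Finsupp.linearCombination_single, smul_eq_mul]

lemma chooseFunctional_apply {R : Type*} [CommRing R] (k : ℕ) (α : Fin d → ℕ)
    (a : MonoidAlgebra R (G ⧸ lowerPSeries G p k)) :
    hG.chooseFunctional hg R k α a =
      ∑ x ∈ a.coeff.support, a.coeff x * multiChoose (hG.exponent hg k x) α :=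
  Finsupp.linearCombination_apply R a.coeff

lemma chooseFunctional_map {R : Type*} [CommRing R] (k : ℕ) (α : Fin d → ℕ)
    (a : MonoidAlgebra ℤ (G ⧸ lowerPSeries G p k)) :
    hG.chooseFunctional hg R k α (mapRingHom _ (Int.castRingHom R) a) =
      (hG.chooseFunctional hg ℤ k α a : R) := by
  induction a using MonoidAlgebra.induction_linear with
  | zero => simp
  | add a b ha hb => rw [map_add, map_add, map_add, ha, hb, Int.cast_add]
  | single x r => simp [chooseFunctional_single]

lemma pow_dvd_chooseFunctional_sub_choose (k : ℕ) (α n : Fin d → ℕ) :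
    (p : ℤ) ^ (k - chooseLoss p α) ∣ hG.chooseFunctional hg ℤ k α
      (single ((orderedPow g n : G) : G ⧸ lowerPSeries G p k) 1) - multiChoose n α := by
  rw [chooseFunctional_single, one_mul]
  exact pow_dvd_multiChoose_sub α (hG.exponent_modEq hg k n)

/-- The functional `chooseFunctional` computes the coefficients of the ordered monomials up to
a power of `p`. -/
lemma pow_dvd_chooseFunctional_orderedPow_sub (k : ℕ) (α β : Fin d → ℕ) :
    (p : ℤ) ^ (k - chooseLoss p α) ∣ hG.chooseFunctional hg ℤ k α
      (orderedPow (fun j => single (g j : G ⧸ lowerPSeries G p k) (1 : ℤ) - 1) β) -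
        if β = α then 1 else 0 := by
  -- Apply the functional to `[g^β] = ∑ binom(β,γ) b^γ`. Its value is `binom(β,α) = ∑ binom(β,γ)
  -- δ_{γα}` up to the allowed error. The term `γ = β` has coefficient 1, and all other terms have
  -- smaller degree.
  induction hm : ∑ j, β j using Nat.strong_induction_on generalizing β with
  | _ m ih =>
    set D := (p : ℤ) ^ (k - chooseLoss p α)
    set Λ := hG.chooseFunctional hg ℤ k α
    set b := fun j => single (g j : G ⧸ lowerPSeries G p k) (1 : ℤ) - 1
    have hN : ∀ j, β j < m + 1 := fun j => by
      have := Finset.single_le_sum (f := β) (fun i _ => Nat.zero_le _) (Finset.mem_univ j)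
      omega
    have hβ : β ∈ Fintype.piFinset fun _ : Fin d => Finset.range (m + 1) := by
      simpa [Fintype.mem_piFinset] using hN
    have h1 := hG.pow_dvd_chooseFunctional_sub_choose hg k α β
    rw [← QuotientGroup.mk'_apply, map_orderedPow, single_orderedPow_eq_sum _ hN, map_sum] at h1
    have h2 : ((multiChoose β α : ℕ) : ℤ) =
        ∑ γ ∈ Fintype.piFinset fun _ : Fin d => Finset.range (m + 1),
          ((multiChoose β γ : ℕ) : ℤ) * if γ = α then 1 else 0 := by
      simp only [mul_ite, mul_one, mul_zero, Finset.sum_ite_eq']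
      split_ifs with hα
      · rfl
      · rw [multiChoose_eq_zero, Nat.cast_zero]
        intro hle
        refine hα ?_
        simp only [Fintype.mem_piFinset, Finset.mem_range]
        exact fun j => (hle j).trans_lt (hN j)
    rw [h2, ← Finset.sum_sub_distrib] at h1
    simp only [map_smul, smul_eq_mul, ← mul_sub] at h1
    rw [← Finset.add_sum_erase _ _ hβ, multiChoose_self, Nat.cast_one, one_mul] at h1
    refine (dvd_add_left (Finset.dvd_sum fun γ hγ => ?_)).mp h1
    by_cases hle : γ ≤ β
    · refine Dvd.dvd.mul_left (ih _ ?_ γ rfl) _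
      rw [← hm]
      refine Finset.sum_lt_sum (fun j _ => hle j) ?_
      by_contra! hge
      exact (Finset.mem_erase.mp hγ).1 (funext fun j => le_antisymm (hle j) (hge j (Finset.mem_univ j)))
    · rw [multiChoose_eq_zero hle]
      simp

/-- Write the element through terms `p^a b^β` with `a + |β| ≥ n` plus a multiple of `p^k`. Terms
with `β = α` carry `a ≥ n - |α|`; for the others the functional vanishes up to `p^{k - chooseLoss p
α}`. -/
lemma pow_dvd_chooseFunctional_of_mem (k n : ℕ) (α : Fin d → ℕ)
    {a : MonoidAlgebra ℤ (G ⧸ lowerPSeries G p k)} (ha : a ∈ augModulo p (G ⧸ lowerPSeries G p k) ^ n) :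
    (p : ℤ) ^ min (n - ∑ j, α j) (k - chooseLoss p α) ∣ hG.chooseFunctional hg ℤ k α a := by
  have := hG.finite_quotient k
  obtain ⟨T, hT⟩ := (isPGroup_quotient_lowerPSeries (G := G) (p := p) k).exists_mem_augModulo_pow_imp k
  have h1 := augModulo_pow_le_orderedSpan_ge_sup (hG.closure_range_mk hg k)
    (hG.commutator_quotient_mem k) n T ha
  obtain ⟨b, hb, c, hc, rfl⟩ := Submodule.mem_sup.mp h1
  clear h1 ha
  rw [map_add]
  refine dvd_add ?_ ?_
  · induction hb using Submodule.span_induction with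
    | mem y hy =>
      obtain ⟨e, β, h, rfl⟩ := hy
      rw [← Nat.cast_pow (α := MonoidAlgebra ℤ _), ← nsmul_eq_mul, map_nsmul, nsmul_eq_mul,
        Nat.cast_pow]
      have h2 := hG.pow_dvd_chooseFunctional_orderedPow_sub hg k α β
      split_ifs at h2 with hβ
      · subst hβ
        exact Dvd.dvd.mul_right (pow_dvd_pow _ (min_le_of_left_le (by omega))) _
      · rw [sub_zero] at h2
        exact Dvd.dvd.mul_left ((pow_dvd_pow _ (min_le_right _ _)).trans h2) _
    | zero => simp
    | add x y _ _ hx hy => rw [map_add]; exact dvd_add hx hy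
    | smul r x _ hx => rw [map_smul]; exact Dvd.dvd.mul_left hx _
  · obtain ⟨u, rfl⟩ := hT n c hc
    rw [← Nat.cast_pow (α := MonoidAlgebra ℤ _), ← nsmul_eq_mul, map_nsmul, nsmul_eq_mul,
      Nat.cast_pow]
    exact Dvd.dvd.mul_right (pow_dvd_pow _ (min_le_of_right_le (Nat.sub_le _ _))) _

end IsUniformProPGroup

/-! ### Coefficient bounds in the completed group ring. -/

section CoefficientBounds

open Filter Topology

lemma norm_intCast_le {R : Type*} [NormedCommRing R] {p : ℕ} [Fact p.Prime] [Algebra ℤ_[p] R]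
    (hR : ∀ z : ℤ_[p], ‖algebraMap ℤ_[p] R z‖ ≤ ‖z‖) {e : ℕ} {z : ℤ} (h : (p : ℤ) ^ e ∣ z) :
    ‖(z : R)‖ ≤ (1 / (p : ℝ)) ^ e := by
  rw [← map_intCast (algebraMap ℤ_[p] R) z]
  refine (hR _).trans ((PadicInt.norm_int_le_pow_iff_dvd.mpr (by exact_mod_cast h)).trans ?_)
  rw [zpow_neg, zpow_natCast, one_div, inv_pow]

variable {R : Type*} [NormedCommRing R] [IsUltrametricDist R] {G : Type*} [Group G]
  [TopologicalSpace G]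

/-- All coefficients of the element of the completed group ring are bounded by `C`. -/
def CoeffBounded (μ : CompletedGroupRing R G) (C : ℝ) : Prop :=
  ∀ (N : OpenNormalSubgroup G) (h : G ⧸ (N : Subgroup G)), ‖(μ.1 N).coeff h‖ ≤ C

lemma exists_coeffBounded (μ : CompletedGroupRing R G) : ∃ C, 0 ≤ C ∧ CoeffBounded μ C :=
  μ.2.2

lemma CoeffBounded.mul {μ ν : CompletedGroupRing R G} {C D : ℝ} (hC : 0 ≤ C) (hD : 0 ≤ D)
    (hμ : CoeffBounded μ C) (hν : CoeffBounded ν D) : CoeffBounded (μ * ν) (C * D) :=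
  fun N => norm_coeff_mul_le _ _ hC hD (hμ N) (hν N)

lemma CoeffBounded.smul {μ : CompletedGroupRing R G} {C D : ℝ} {c : R} (hc : ‖c‖ ≤ D)
    (hμ : CoeffBounded μ C) (hD : 0 ≤ D) : CoeffBounded (c • μ) (D * C) :=
  fun N x => (norm_mul_le _ _).trans (mul_le_mul hc (hμ N x) (norm_nonneg _) hD)

lemma CoeffBounded.sum {ι : Type*} {μ : ι → CompletedGroupRing R G} {C : ℝ} (hC : 0 ≤ C)
    {F : Finset ι} (hμ : ∀ i ∈ F, CoeffBounded (μ i) C) : CoeffBounded (∑ i ∈ F, μ i) C := by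
  classical
  induction F using Finset.induction_on with
  | empty =>
    intro N x
    simpa using hC
  | insert i F hi ih =>
    rw [Finset.sum_insert hi]
    intro N x
    exact (IsUltrametricDist.norm_add_le_max _ _).trans
      (max_le (hμ i (Finset.mem_insert_self _ _) N x)
        (ih (fun j hj => hμ j (Finset.mem_insert_of_mem hj)) N x))

lemma coeff_mapDomain_eq_sum {R : Type*} [CommRing R] {X Y : Type*} [Fintype X] [DecidableEq Y]
    (f : X → Y) (a : MonoidAlgebra R X) (y : Y) :
    (MonoidAlgebra.mapDomain f a).coeff y = ∑ x, if f x = y then a.coeff x else 0 := by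
  change (Finsupp.mapDomain f a.coeff) y = _
  rw [Finsupp.mapDomain, Finsupp.sum_fintype _ _ (by simp), Finsupp.finsetSum_apply]
  simp [Finsupp.single_apply]

lemma coeff_mul_eq_sum {R : Type*} [CommRing R] {X : Type*} [Group X] [Fintype X] [DecidableEq X]
    (a b : MonoidAlgebra R X) (z : X) :
    (a * b).coeff z = ∑ x, ∑ y, if x * y = z then a.coeff x * b.coeff y else 0 := by
  rw [MonoidAlgebra.coeff_mul, Finsupp.sum_fintype _ _ (by simp)]
  refine Finset.sum_congr rfl fun x _ => ?_
  rw [Finsupp.sum_fintype _ _ (by simp)]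

variable (R) in
/-- The product of the elements `[x] - 1` over a list of group elements. -/
noncomputable def augProduct (l : List G) : CompletedGroupRing R G :=
  (l.map fun x => groupElement R x - 1).prod

lemma augProduct_append (l l' : List G) :
    augProduct R (l ++ l') = augProduct R l * augProduct R l' := by
  simp [augProduct]

lemma monomial_eq_augProduct {d : ℕ} (g : Fin d → G) (α : Fin d → ℕ) :
    ∃ l : List G, l.length = ∑ j, α j ∧ monomial R g α = augProduct R l := by
  refine ⟨((List.ofFn fun j => List.replicate (α j) j).flatten).map g, ?_, ?_⟩
  · rw [List.length_map, List.length_flatten, List.map_ofFn, List.sum_ofFn]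
    simp
  · rw [augProduct, List.map_map]
    exact (prod_map_flatten_ofFn_replicate (fun j => groupElement R (g j) - 1) α).symm

lemma augProduct_apply (l : List G) (N : OpenNormalSubgroup G) :
    (augProduct R l).1 N = MonoidAlgebra.mapRingHom _ (Int.castRingHom R)
      (l.map fun x : G => MonoidAlgebra.single (x : G ⧸ (N : Subgroup G)) (1 : ℤ) - 1).prod := by
  have h : ∀ μ : CompletedGroupRing R G, μ.1 N =
      ((Pi.evalRingHom _ N).comp (CompletedGroupRing R G).subtype) μ := fun _ => rfl
  rw [h, augProduct, map_list_prod, map_list_prod, List.map_map, List.map_map]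
  congr 1
  refine List.map_congr_left fun x _ => ?_
  rw [Function.comp_apply, Function.comp_apply, map_sub, map_one,
    MonoidAlgebra.mapRingHom_single, map_one]
  rfl

variable {p : ℕ} [Fact p.Prime] [Algebra ℤ_[p] R] (hR : ∀ z : ℤ_[p], ‖algebraMap ℤ_[p] R z‖ ≤ ‖z‖)

include hR in
lemma coeffBounded_augProduct (l : List G) : CoeffBounded (augProduct R l) 1 := by
  intro N x
  rw [augProduct_apply, MonoidAlgebra.coeff_mapRingHom]
  simpa using norm_intCast_le hR (e := 0) (one_dvd _)

include hR in
lemma coeffBounded_monomial {d : ℕ} (g : Fin d → G) (α : Fin d → ℕ) :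
    CoeffBounded (monomial R g α) 1 := by
  obtain ⟨l, -, h⟩ := monomial_eq_augProduct (R := R) g α
  rw [h]
  exact coeffBounded_augProduct hR l

/-- The partial sums of an expansion. -/
noncomputable def partialSum {d : ℕ} (g : Fin d → G) (c : (Fin d → ℕ) → R)
    (F : Finset (Fin d → ℕ)) : CompletedGroupRing R G :=
  ∑ α ∈ F, c α • monomial R g α

include hR in
lemma coeffBounded_partialSum {d : ℕ} (g : Fin d → G) {c : (Fin d → ℕ) → R} {C : ℝ} (hC : 0 ≤ C)
    (hc : ∀ α, ‖c α‖ ≤ C) (F : Finset (Fin d → ℕ)) : CoeffBounded (partialSum g c F) C :=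
  CoeffBounded.sum hC fun α _ => by
    simpa using (coeffBounded_monomial hR g α).smul (hc α) hC

lemma tendsto_coeff_partialSum {d : ℕ} {g : Fin d → G} {μ : CompletedGroupRing R G}
    {c : (Fin d → ℕ) → R} (h : IsExpansion g μ c) (N : OpenNormalSubgroup G)
    (x : G ⧸ (N : Subgroup G)) :
    Tendsto (fun F => ((partialSum g c F).1 N).coeff x) atTop (𝓝 ((μ.1 N).coeff x)) := by
  have h1 : ∀ F, ((partialSum g c F).1 N).coeff x =
      ∑ α ∈ F, c α * ((monomial R g α).1 N).coeff x := by
    intro F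
    let f : CompletedGroupRing R G →+ R :=
      { toFun := fun μ => (μ.1 N).coeff x, map_zero' := rfl, map_add' := fun _ _ => rfl }
    exact map_sum f _ _
  simp only [h1]
  exact h.hasSum N x

end CoefficientBounds

open Filter Topology in
lemma tendsto_const_mul_pow_sub (p : ℕ) [Fact p.Prime] (C : ℝ) (v : ℕ) :
    Tendsto (fun k => C * (1 / (p : ℝ)) ^ (k - v)) atTop (𝓝 0) := by
  have hpp : p.Prime := Fact.out
  have h1 : Tendsto (fun k : ℕ => (1 / (p : ℝ)) ^ k) atTop (𝓝 0) :=
    tendsto_pow_atTop_nhds_zero_of_lt_one (by positivity)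
      (by rw [div_lt_one (by exact_mod_cast hpp.pos)]; exact_mod_cast hpp.one_lt)
  simpa using (h1.comp (tendsto_sub_atTop_nat v)).const_mul C

section

open MonoidAlgebra Filter Topology

lemma orderedPow_eq_map_int {R : Type*} [CommRing R] {d : ℕ} {H : Type*} [Group H] (g : Fin d → H) (α : Fin d → ℕ) :
    orderedPow (fun j => single (g j) (1 : R) - 1) α = mapRingHom _ (Int.castRingHom R)
      (orderedPow (fun j => single (g j) (1 : ℤ) - 1) α) := by
  have := map_orderedPow ((mapRingHom H (Int.castRingHom R) : _ →+* _) : MonoidAlgebra ℤ H →* MonoidAlgebra R H)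
    (fun j => single (g j) (1 : ℤ) - 1) α
  refine Eq.trans ?_ this.symm
  congr 1
  ext1 j
  change _ = mapRingHom H (Int.castRingHom R) _
  rw [map_sub, map_one, mapRingHom_single, map_one]

end

/-! ### The coefficient functionals as limits. -/

namespace IsUniformProPGroup

open MonoidAlgebra Filter Topology

variable {G : Type*} [Group G] [TopologicalSpace G] [IsTopologicalGroup G] {p : ℕ} [Fact p.Prime]
  (hG : IsUniformProPGroup p G) {d : ℕ} {g : Fin d → G} (hg : IsMinimalGenerators g)
  {R : Type*} [NormedCommRing R] [IsUltrametricDist R]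

variable (R) in
/-- The image of an element of the completed group ring in the group ring of the quotient by the
`k`-th term of the lower `p`-series. -/
noncomputable def level (k : ℕ) :
    CompletedGroupRing R G →ₗ[R] MonoidAlgebra R (G ⧸ lowerPSeries G p k) where
  toFun μ := μ.1 (hG.openLowerPSeries k)
  map_add' _ _ := rfl
  map_smul' _ _ := rfl

lemma mapDomain_level {k l : ℕ} (h : k ≤ l) (μ : CompletedGroupRing R G) :
    mapDomainRingHom R (QuotientGroup.map (lowerPSeries G p l) (lowerPSeries G p k)
      (MonoidHom.id G) (lowerPSeries_antitone h)) (hG.level R l μ) = hG.level R k μ :=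
  μ.2.1 (hG.openLowerPSeries l) (hG.openLowerPSeries k) (lowerPSeries_antitone h)

lemma level_augProduct (k : ℕ) (l : List G) :
    hG.level R k (augProduct R l) = mapRingHom _ (Int.castRingHom R)
      (l.map fun x : G => single (x : G ⧸ lowerPSeries G p k) (1 : ℤ) - 1).prod :=
  augProduct_apply l _

lemma level_monomial (k : ℕ) (α : Fin d → ℕ) :
    hG.level R k (monomial R g α) =
      orderedPow (fun j => single (g j : G ⧸ lowerPSeries G p k) (1 : R) - 1) α := by
  let f : CompletedGroupRing R G →* MonoidAlgebra R (G ⧸ lowerPSeries G p k) :=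
    { toFun := fun μ => hG.level R k μ, map_one' := rfl, map_mul' := fun _ _ => rfl }
  exact map_orderedPow f (fun j => groupElement R (g j) - 1) α

/-- The approximations to the coefficient of `b ^ α`. -/
noncomputable def approxCoeff (k : ℕ) (α : Fin d → ℕ) : CompletedGroupRing R G →ₗ[R] R :=
  hG.chooseFunctional hg R k α ∘ₗ hG.level R k

variable [Algebra ℤ_[p] R] (hR : ∀ z : ℤ_[p], ‖algebraMap ℤ_[p] R z‖ ≤ ‖z‖)

include hR

lemma norm_approxCoeff_le (k : ℕ) (α : Fin d → ℕ) {μ : CompletedGroupRing R G} {C : ℝ} (hC : 0 ≤ C)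
    (hμ : ∀ x, ‖(hG.level R k μ).coeff x‖ ≤ C) : ‖hG.approxCoeff hg k α μ‖ ≤ C := by
  rw [approxCoeff, LinearMap.comp_apply, chooseFunctional_apply]
  refine IsUltrametricDist.norm_sum_le_of_forall_le_of_nonneg hC fun x _ => ?_
  have h1 := norm_intCast_le hR (e := 0) (z := multiChoose (hG.exponent hg k x) α) (one_dvd _)
  rw [pow_zero, Int.cast_natCast] at h1
  refine (norm_mul_le _ _).trans ?_
  simpa using mul_le_mul (hμ x) h1 (norm_nonneg _) hC

/-- Both functionals are sums over `G/P_l`: the exponents of a class at levels `k` and `l` agree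
modulo `p^k`, so the binomial weights differ by a multiple of `p^{k - chooseLoss p α}`. -/
lemma norm_approxCoeff_sub_le {k l : ℕ} (h : k ≤ l) (α : Fin d → ℕ) {μ : CompletedGroupRing R G}
    {C : ℝ} (hC : 0 ≤ C) (hμ : CoeffBounded μ C) :
    ‖hG.approxCoeff hg l α μ - hG.approxCoeff hg k α μ‖ ≤
      C * (1 / (p : ℝ)) ^ (k - chooseLoss p α) := by
  have h1 : hG.approxCoeff hg k α μ = ∑ x ∈ (hG.level R l μ).coeff.support,
      (hG.level R l μ).coeff x * multiChoose (hG.exponent hg k (QuotientGroup.map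
        (lowerPSeries G p l) (lowerPSeries G p k) (MonoidHom.id G) (lowerPSeries_antitone h) x)) α := by
    rw [approxCoeff, LinearMap.comp_apply, ← hG.mapDomain_level h]
    refine (Finsupp.linearCombination_mapDomain R _ _).trans ?_
    rw [Finsupp.linearCombination_apply]
    rfl
  rw [h1, approxCoeff, LinearMap.comp_apply, chooseFunctional_apply, ← Finset.sum_sub_distrib]
  refine IsUltrametricDist.norm_sum_le_of_forall_le_of_nonneg (by positivity) fun x _ => ?_
  rw [← mul_sub]
  refine (norm_mul_le _ _).trans (mul_le_mul (hμ (hG.openLowerPSeries l) x) ?_ (norm_nonneg _) hC)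
  have h2 : QuotientGroup.map (lowerPSeries G p l) (lowerPSeries G p k) (MonoidHom.id G)
      (lowerPSeries_antitone h) x = ((orderedPow g (hG.exponent hg l x) : G) : G ⧸ _) := by
    conv_lhs => rw [← hG.mk_orderedPow_exponent hg l x]
    rfl
  have h3 := norm_intCast_le hR (pow_dvd_multiChoose_sub α (k := k) fun j =>
    (hG.exponent_modEq hg k (hG.exponent hg l x) j).symm)
  rw [h2]
  push_cast at h3
  exact h3

variable [CompleteSpace R]

lemma exists_tendsto_approxCoeff (α : Fin d → ℕ) (μ : CompletedGroupRing R G) :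
    ∃ c, Tendsto (fun k => hG.approxCoeff hg k α μ) atTop (𝓝 c) := by
  obtain ⟨C, hC, hμ⟩ := exists_coeffBounded μ
  refine cauchySeq_tendsto_of_complete (cauchySeq_of_le_tendsto_0
    (fun k => C * (1 / (p : ℝ)) ^ (k - chooseLoss p α)) (fun n m k hn hm => ?_)
    (tendsto_const_mul_pow_sub p C _))
  have h1 := hG.norm_approxCoeff_sub_le hg hR hn α hC hμ
  have h2 := hG.norm_approxCoeff_sub_le hg hR hm α hC hμ
  rw [← dist_eq_norm] at h1 h2
  rw [dist_comm] at h2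
  exact (dist_triangle_max _ _ _).trans (max_le h1 h2)

/-- The coefficient of `b ^ α` in the expansion of an element of the completed group ring. -/
noncomputable def coeffFunctional (α : Fin d → ℕ) : CompletedGroupRing R G →ₗ[R] R where
  toFun μ := (hG.exists_tendsto_approxCoeff hg hR α μ).choose
  map_add' μ ν := by
    refine tendsto_nhds_unique (hG.exists_tendsto_approxCoeff hg hR α (μ + ν)).choose_spec ?_
    simp only [map_add]
    exact (hG.exists_tendsto_approxCoeff hg hR α μ).choose_spec.add
      (hG.exists_tendsto_approxCoeff hg hR α ν).choose_spec
  map_smul' c μ := by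
    refine tendsto_nhds_unique (hG.exists_tendsto_approxCoeff hg hR α (c • μ)).choose_spec ?_
    simp only [map_smul]
    exact (hG.exists_tendsto_approxCoeff hg hR α μ).choose_spec.const_smul c

lemma tendsto_approxCoeff (α : Fin d → ℕ) (μ : CompletedGroupRing R G) :
    Tendsto (fun k => hG.approxCoeff hg k α μ) atTop (𝓝 (hG.coeffFunctional hg hR α μ)) :=
  (hG.exists_tendsto_approxCoeff hg hR α μ).choose_spec

lemma norm_coeffFunctional_sub_le (k : ℕ) (α : Fin d → ℕ) {μ : CompletedGroupRing R G}
    {C : ℝ} (hC : 0 ≤ C) (hμ : CoeffBounded μ C) :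
    ‖hG.coeffFunctional hg hR α μ - hG.approxCoeff hg k α μ‖ ≤
      C * (1 / (p : ℝ)) ^ (k - chooseLoss p α) :=
  le_of_tendsto ((hG.tendsto_approxCoeff hg hR α μ).sub_const _).norm
    (eventually_atTop.mpr ⟨k, fun _ h => hG.norm_approxCoeff_sub_le hg hR h α hC hμ⟩)

lemma norm_coeffFunctional_le (α : Fin d → ℕ) {μ : CompletedGroupRing R G} {C : ℝ} (hC : 0 ≤ C)
    (hμ : CoeffBounded μ C) : ‖hG.coeffFunctional hg hR α μ‖ ≤ C :=
  le_of_tendsto (hG.tendsto_approxCoeff hg hR α μ).norm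
    (Eventually.of_forall fun k => hG.norm_approxCoeff_le hg hR k α hC fun x => hμ (hG.openLowerPSeries k) x)

lemma coeffFunctional_monomial (α β : Fin d → ℕ) :
    hG.coeffFunctional hg hR α (monomial R g β) = if β = α then 1 else 0 := by
  refine tendsto_nhds_unique (hG.tendsto_approxCoeff hg hR α _) ?_
  rw [tendsto_iff_norm_sub_tendsto_zero]
  refine squeeze_zero (fun _ => norm_nonneg _) (fun k => ?_)
    (tendsto_const_mul_pow_sub p 1 (chooseLoss p α))
  rw [one_mul, approxCoeff, LinearMap.comp_apply, level_monomial, orderedPow_eq_map_int,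
    chooseFunctional_map]
  have := norm_intCast_le hR (hG.pow_dvd_chooseFunctional_orderedPow_sub hg k α β)
  push_cast at this
  exact this

/-- The product lies in `J^{l.length}` at every level; once `k` exceeds `chooseLoss p α` by at least
`l.length - |α|`, the loss no longer limits the divisibility. The bound is independent of the
generators, since the entries of `l` are arbitrary. -/
lemma norm_coeffFunctional_augProduct_le (α : Fin d → ℕ) (l : List G) :
    ‖hG.coeffFunctional hg hR α (augProduct R l)‖ ≤ (1 / (p : ℝ)) ^ (l.length - ∑ j, α j) := by
  refine le_of_tendsto (hG.tendsto_approxCoeff hg hR α _).norm (eventually_atTop.mpr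
    ⟨(l.length - ∑ j, α j) + chooseLoss p α, fun k hk => ?_⟩)
  rw [approxCoeff, LinearMap.comp_apply, level_augProduct, chooseFunctional_map]
  refine norm_intCast_le hR ?_
  have hmem : (l.map fun x : G => single (x : G ⧸ lowerPSeries G p k) (1 : ℤ) - 1).prod ∈
      augModulo p (G ⧸ lowerPSeries G p k) ^ l.length := by
    clear hk
    induction l with
    | nil => exact Submodule.one_le.mp le_rfl
    | cons x l ih =>
      rw [List.map_cons, List.prod_cons, List.length_cons, pow_succ']
      exact Submodule.mul_mem_mul (single_sub_one_mem_augModulo _) ih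
  have := hG.pow_dvd_chooseFunctional_of_mem hg k l.length α hmem
  rwa [min_eq_left (by omega)] at this

/-- On a bounded set the functional is uniformly approximated by its level-`k` version, which
involves only the finitely many coefficients on `G/P_k`. -/
lemma tendsto_coeffFunctional {ι : Type*} {F : Filter ι} {ν : ι → CompletedGroupRing R G}
    {μ : CompletedGroupRing R G} {C : ℝ} (hC : 0 ≤ C) (hν : ∀ i, CoeffBounded (ν i) C)
    (h : ∀ (N : OpenNormalSubgroup G) (x : G ⧸ (N : Subgroup G)),
      Tendsto (fun i => ((ν i).1 N).coeff x) F (𝓝 ((μ.1 N).coeff x))) (α : Fin d → ℕ) :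
    Tendsto (fun i => hG.coeffFunctional hg hR α (ν i)) F (𝓝 (hG.coeffFunctional hg hR α μ)) := by
  obtain ⟨D, hD, hμ⟩ := exists_coeffBounded μ
  rw [Metric.tendsto_nhds]
  intro ε hε
  obtain ⟨k, hk⟩ := (((tendsto_const_mul_pow_sub p (max C D) (chooseLoss p α)).eventually
    (gt_mem_nhds hε))).exists
  have hfin := hG.finite_quotient k
  have h1 : ∀ᶠ i in F, ∀ x, ‖(hG.level R k (ν i - μ)).coeff x‖ ≤ ε / 2 := by
    rw [eventually_all]
    intro x
    have := tendsto_iff_norm_sub_tendsto_zero.mp (h (hG.openLowerPSeries k) x)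
    filter_upwards [this.eventually (gt_mem_nhds (half_pos hε))] with i hi
    exact hi.le
  filter_upwards [h1] with i hi
  have hb : CoeffBounded (ν i - μ) (max C D) := fun N x => by
    change ‖((ν i).1 N).coeff x - (μ.1 N).coeff x‖ ≤ _
    rw [sub_eq_add_neg]
    refine (IsUltrametricDist.norm_add_le_max _ _).trans (max_le_max (hν i N x) ?_)
    rw [norm_neg]
    exact hμ N x
  rw [dist_eq_norm, ← map_sub]
  have h2 := hG.norm_coeffFunctional_sub_le hg hR k α (hC.trans (le_max_left C D)) hb
  have h3 := hG.norm_approxCoeff_le hg hR k α (half_pos hε).le hi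
  rw [← sub_add_cancel (hG.coeffFunctional hg hR α (ν i - μ)) (hG.approxCoeff hg k α (ν i - μ))]
  exact (IsUltrametricDist.norm_add_le_max _ _).trans_lt
    (max_lt (h2.trans_lt hk) (h3.trans_lt (half_lt_self hε)))

lemma coeffFunctional_partialSum (c : (Fin d → ℕ) → R) {F : Finset (Fin d → ℕ)} {α : Fin d → ℕ}
    (hα : α ∈ F) : hG.coeffFunctional hg hR α (partialSum g c F) = c α := by
  simp only [partialSum, map_sum, map_smul, coeffFunctional_monomial, smul_eq_mul, mul_ite, mul_one,
    mul_zero, Finset.sum_ite_eq', if_pos hα]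

lemma eq_coeffFunctional_of_isExpansion {μ : CompletedGroupRing R G} {c : (Fin d → ℕ) → R}
    (h : IsExpansion g μ c) (α : Fin d → ℕ) : c α = hG.coeffFunctional hg hR α μ := by
  obtain ⟨C, hC⟩ := h.bounded
  have hC0 : 0 ≤ C := (norm_nonneg _).trans (hC 0)
  refine tendsto_nhds_unique ?_ (hG.tendsto_coeffFunctional hg hR hC0
    (coeffBounded_partialSum hR g hC0 hC) (tendsto_coeff_partialSum h) α)
  refine tendsto_const_nhds.congr' (eventually_atTop.mpr ⟨{α}, fun F hF => ?_⟩)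
  exact (hG.coeffFunctional_partialSum hg hR c (hF (Finset.mem_singleton_self α))).symm

end IsUniformProPGroup

lemma finite_sum_lt {d : ℕ} (T : ℕ) : {α : Fin d → ℕ | ∑ j, α j < T}.Finite := by
  refine (Set.finite_Iic (fun _ : Fin d => T)).subset fun α hα j => ?_
  have := Finset.single_le_sum (f := α) (fun i _ => Nat.zero_le _) (Finset.mem_univ j)
  exact this.trans (le_of_lt hα)

/-! ### Existence of expansions and the estimates for the `r`-norm. -/

namespace IsUniformProPGroup

open MonoidAlgebra Filter Topology

variable {G : Type*} [Group G] [TopologicalSpace G] [IsTopologicalGroup G] {p : ℕ} [Fact p.Prime]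
  (hG : IsUniformProPGroup p G) {d : ℕ} {g : Fin d → G} (hg : IsMinimalGenerators g)

include hg in
lemma eq_sum_chooseFunctional {R : Type*} [CommRing R] (k : ℕ)
    (a : MonoidAlgebra R (G ⧸ lowerPSeries G p k)) :
    a = ∑ α ∈ Fintype.piFinset fun _ : Fin d => Finset.range (p ^ k),
      hG.chooseFunctional hg R k α a •
        orderedPow (fun j => single (g j : G ⧸ lowerPSeries G p k) (1 : R) - 1) α := by
  induction a using MonoidAlgebra.induction_linear with
  | zero => simp
  | add a b ha hb =>
    simp only [map_add, add_smul, Finset.sum_add_distrib]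
    rw [← ha, ← hb]
  | single x r =>
    simp only [chooseFunctional_single, mul_smul]
    rw [← Finset.smul_sum, ← single_orderedPow_eq_sum _ (hG.exponent_lt hg k x), smul_single,
      smul_eq_mul, mul_one]
    congr 1
    conv_lhs => rw [← hG.mk_orderedPow_exponent hg k x]
    exact map_orderedPow (QuotientGroup.mk' (lowerPSeries G p k)) g _

variable {R : Type*} [NormedCommRing R] [IsUltrametricDist R]

include hg in
-- An exact finite expansion at level `k`, pushed down to level `m`; letting `k` grow with `m` fixed
-- turns it into the infinite one.
lemma level_eq_sum {m k : ℕ} (h : m ≤ k) (μ : CompletedGroupRing R G) :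
    hG.level R m μ = ∑ α ∈ Fintype.piFinset fun _ : Fin d => Finset.range (p ^ k),
      hG.approxCoeff hg k α μ • hG.level R m (monomial R g α) := by
  rw [← hG.mapDomain_level h, hG.eq_sum_chooseFunctional hg k (hG.level R k μ), map_sum]
  refine Finset.sum_congr rfl fun α _ => ?_
  rw [← hG.mapDomain_level h (monomial R g α), ← hG.level_monomial]
  exact map_smul (mapDomainAlgHom R R _) _ _

variable [Algebra ℤ_[p] R] (hR : ∀ z : ℤ_[p], ‖algebraMap ℤ_[p] R z‖ ≤ ‖z‖)

include hR

/-- The monomials of large degree are `p`-adically small in the group ring of a finite quotient. -/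
lemma exists_norm_level_monomial_le (m e : ℕ) : ∃ T, ∀ α : Fin d → ℕ, T ≤ ∑ j, α j →
    ∀ x, ‖(hG.level R m (monomial R g α)).coeff x‖ ≤ (1 / (p : ℝ)) ^ e := by
  have := hG.finite_quotient m
  obtain ⟨T, hT⟩ :=
    (isPGroup_quotient_lowerPSeries (G := G) (p := p) m).exists_mem_augModulo_pow_imp e
  refine ⟨T, fun α hα x => ?_⟩
  obtain ⟨l, hl, hlα⟩ := monomial_eq_augProduct (R := R) g α
  have hmem : ∀ l : List G, (l.map fun x : G => single (x : G ⧸ lowerPSeries G p m) (1 : ℤ) - 1).prod ∈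
      augModulo p (G ⧸ lowerPSeries G p m) ^ l.length := by
    intro l
    induction l with
    | nil => exact Submodule.one_le.mp le_rfl
    | cons x l ih =>
      rw [List.map_cons, List.prod_cons, List.length_cons, pow_succ']
      exact Submodule.mul_mem_mul (single_sub_one_mem_augModulo _) ih
  have hm := hmem l
  rw [hl, ← Nat.sub_add_cancel hα] at hm
  obtain ⟨u, hu⟩ := hT _ _ hm
  rw [hlα, level_augProduct, hu, coeff_mapRingHom]
  refine norm_intCast_le hR ?_
  rw [← Nat.cast_pow (α := MonoidAlgebra ℤ _), ← nsmul_eq_mul]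
  refine ⟨u.coeff x, ?_⟩
  rw [coeff_smul_apply, nsmul_eq_mul, Nat.cast_pow]

variable [CompleteSpace R]

lemma hasSum_level (m : ℕ) (μ : CompletedGroupRing R G) (x : G ⧸ lowerPSeries G p m) :
    HasSum (fun α => hG.coeffFunctional hg hR α μ * (hG.level R m (monomial R g α)).coeff x)
      ((hG.level R m μ).coeff x) := by
  obtain ⟨C, hC, hμ⟩ := exists_coeffBounded μ
  set f : (Fin d → ℕ) → R := fun α =>
    hG.coeffFunctional hg hR α μ * (hG.level R m (monomial R g α)).coeff x with hf
  have hsmall : ∀ ε > 0, ∃ T, ∀ α : Fin d → ℕ, T ≤ ∑ j, α j →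
      C * ‖(hG.level R m (monomial R g α)).coeff x‖ < ε := by
    intro ε hε
    obtain ⟨e, he⟩ := ((tendsto_const_mul_pow_sub p C 0).eventually (gt_mem_nhds hε)).exists
    obtain ⟨T, hT⟩ := hG.exists_norm_level_monomial_le (g := g) hR m e
    exact ⟨T, fun α hα => (mul_le_mul_of_nonneg_left (hT α hα x) hC).trans_lt he⟩
  have hsum : Summable f := by
    refine NonarchimedeanAddGroup.summable_of_tendsto_cofinite_zero ?_
    rw [Metric.tendsto_nhds]
    intro ε hε
    obtain ⟨T, hT⟩ := hsmall ε hε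
    refine (finite_sum_lt T).subset fun α hα => ?_
    by_contra hlt
    refine hα ?_
    rw [Set.mem_ofPred_eq, not_lt] at hlt
    simp only [Set.mem_ofPred_eq, dist_zero_right]
    exact (norm_mul_le _ _).trans_lt ((mul_le_mul_of_nonneg_right
      (hG.norm_coeffFunctional_le hg hR α hC hμ) (norm_nonneg _)).trans_lt (hT α hlt))
  -- Summability being known, the sum may be computed along the boxes `[0, p^k)^d`, where the exact
  -- level-`k` formula is available.
  have hbox : Tendsto (fun k => Fintype.piFinset fun _ : Fin d => Finset.range (p ^ k))
      atTop atTop := by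
    refine tendsto_atTop_finset_of_monotone (fun k l h => ?_) fun α => ?_
    · exact Fintype.piFinset_subset _ _ fun _ =>
        Finset.range_mono (Nat.pow_le_pow_right (Fact.out : p.Prime).pos h)
    · refine ⟨∑ j, α j, ?_⟩
      simp only [Fintype.mem_piFinset, Finset.mem_range]
      intro j
      have := Finset.single_le_sum (f := α) (fun i _ => Nat.zero_le _) (Finset.mem_univ j)
      exact this.trans_lt (Nat.lt_pow_self (Fact.out : p.Prime).one_lt)
  have hlim : Tendsto (fun k => ∑ α ∈ Fintype.piFinset fun _ : Fin d => Finset.range (p ^ k), f α)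
      atTop (𝓝 ((hG.level R m μ).coeff x)) := by
    rw [Metric.tendsto_nhds]
    intro ε hε
    obtain ⟨T, hT⟩ := hsmall (ε / 2) (half_pos hε)
    have hlow : ∀ᶠ k in atTop, ∀ α ∈ {α : Fin d → ℕ | ∑ j, α j < T},
        C * (1 / (p : ℝ)) ^ (k - chooseLoss p α) < ε / 2 := by
      rw [(finite_sum_lt T).eventually_all]
      exact fun α _ => (tendsto_const_mul_pow_sub p C (chooseLoss p α)).eventually
        (gt_mem_nhds (half_pos hε))
    filter_upwards [hlow, eventually_ge_atTop m] with k hk hmk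
    have h1 : (hG.level R m μ).coeff x = ∑ α ∈ Fintype.piFinset fun _ : Fin d => Finset.range (p ^ k),
        hG.approxCoeff hg k α μ * (hG.level R m (monomial R g α)).coeff x := by
      rw [hG.level_eq_sum hg hmk μ, coeff_sum, Finsupp.finsetSum_apply]
      rfl
    rw [dist_eq_norm, h1, ← Finset.sum_sub_distrib]
    refine (IsUltrametricDist.norm_sum_le_of_forall_le_of_nonneg (half_pos hε).le
      fun α _ => ?_).trans_lt (half_lt_self hε)
    rw [hf, ← sub_mul]
    refine (norm_mul_le _ _).trans ?_
    have h2 := hG.norm_coeffFunctional_sub_le hg hR k α hC hμ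
    -- In low degree, finitely many approximate coefficients are close to their limits; in high
    -- degree the monomial itself is small and a bound on the coefficients suffices.
    rcases lt_or_ge (∑ j, α j) T with hlt | hge
    · have h3 := coeffBounded_monomial hR g α (hG.openLowerPSeries m) x
      have h4 := mul_le_mul h2 h3 (norm_nonneg _) (by positivity)
      rw [mul_one] at h4
      exact h4.trans (hk α hlt).le
    · have h5 : (1 / (p : ℝ)) ^ (k - chooseLoss p α) ≤ 1 :=
        pow_le_one₀ (by positivity) (by
          rw [div_le_one (by exact_mod_cast (Fact.out : p.Prime).pos)]
          exact_mod_cast (Fact.out : p.Prime).one_lt.le)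
      have h6 := h2.trans (mul_le_mul_of_nonneg_left h5 hC)
      rw [mul_one] at h6
      exact (mul_le_mul_of_nonneg_right h6 (norm_nonneg _)).trans (hT α hge).le
  have := tendsto_nhds_unique (hsum.hasSum.comp hbox) hlim
  rw [← this]
  exact hsum.hasSum

lemma isExpansion_coeffFunctional (μ : CompletedGroupRing R G) :
    IsExpansion g μ fun α => hG.coeffFunctional hg hR α μ := by
  classical
  refine ⟨?_, fun N x => ?_⟩
  · obtain ⟨C, hC, hμ⟩ := exists_coeffBounded μ
    exact ⟨C, fun α => hG.norm_coeffFunctional_le hg hR α hC hμ⟩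
  -- By cofinality, a coefficient in `R[G/N]` is a finite sum of coefficients in `R[G/P_m]`.
  · obtain ⟨m, hm⟩ := hG.toIsProPGroup.exists_lowerPSeries_le N
    have := hG.finite_quotient m
    have := Fintype.ofFinite (G ⧸ lowerPSeries G p m)
    have key : ∀ ν : CompletedGroupRing R G, (ν.1 N).coeff x = ∑ y,
        if QuotientGroup.map (lowerPSeries G p m) (N : Subgroup G) (MonoidHom.id G) hm y = x then
          (hG.level R m ν).coeff y else 0 := by
      intro ν
      rw [← ν.2.1 (hG.openLowerPSeries m) N hm]
      exact coeff_mapDomain_eq_sum (X := G ⧸ lowerPSeries G p m) _ _ _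
    rw [key]
    simp only [key, Finset.mul_sum]
    refine hasSum_sum fun y _ => ?_
    split_ifs
    · exact hG.hasSum_level hg hR m μ y
    · simp [hasSum_zero]

include hG hg in
lemma existsUnique_isExpansion (μ : CompletedGroupRing R G) :
    ∃! c : (Fin d → ℕ) → R, IsExpansion g μ c :=
  ⟨_, hG.isExpansion_coeffFunctional hg hR μ, fun _ h =>
    funext fun α => hG.eq_coeffFunctional_of_isExpansion hg hR h α⟩

lemma expansionCoeff_eq (μ : CompletedGroupRing R G) (α : Fin d → ℕ) :
    expansionCoeff g μ α = hG.coeffFunctional hg hR α μ := by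
  have h : ∃ c, IsExpansion g μ c := ⟨_, hG.isExpansion_coeffFunctional hg hR μ⟩
  rw [expansionCoeff, dif_pos h]
  exact hG.eq_coeffFunctional_of_isExpansion hg hR h.choose_spec α

include hG hg in
lemma bddAbove_expansionCoeff {r : ℝ} (hr : 0 ≤ r) (hr1 : r ≤ 1) (μ : CompletedGroupRing R G) :
    BddAbove (Set.range fun α : Fin d → ℕ => ‖expansionCoeff g μ α‖ * r ^ (∑ j, α j)) := by
  obtain ⟨C, hC, hμ⟩ := exists_coeffBounded μ
  refine ⟨C, ?_⟩
  rintro _ ⟨α, rfl⟩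
  simp only [hG.expansionCoeff_eq hg hR]
  exact (mul_le_mul (hG.norm_coeffFunctional_le hg hR α hC hμ) (pow_le_one₀ hr hr1)
    (by positivity) hC).trans_eq (mul_one C)

/-- The only place where `1/p ≤ r` is essential: it converts the gain `p^{-(l-|α|)}` into
`r^{l-|α|}`. When `|α|` exceeds the length the subtraction truncates, and `r ≤ 1` gives the bound.
-/
lemma norm_coeffFunctional_augProduct_mul_pow_le {r : ℝ} (hr : 1 / (p : ℝ) ≤ r) (hr1 : r ≤ 1)
    (l : List G) (α : Fin d → ℕ) :
    ‖hG.coeffFunctional hg hR α (augProduct R l)‖ * r ^ (∑ j, α j) ≤ r ^ l.length := by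
  have hp : 0 ≤ 1 / (p : ℝ) := by positivity
  have hr0 : 0 ≤ r := hp.trans hr
  calc _ ≤ r ^ (l.length - ∑ j, α j) * r ^ (∑ j, α j) :=
        mul_le_mul_of_nonneg_right ((hG.norm_coeffFunctional_augProduct_le hg hR α l).trans
          (pow_le_pow_left₀ hp hr _)) (by positivity)
    _ = r ^ ((l.length - ∑ j, α j) + ∑ j, α j) := (pow_add _ _ _).symm
    _ ≤ r ^ l.length := pow_le_pow_of_le_one hr0 hr1 (by omega)

include hG hg in
-- A monomial of degree `|β|` in the `g'` is a product of `|β|` elements `[x] - 1`, so its `r`-norm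
-- with respect to `g` is at most `r^{|β|}`. Continuity carries the bound from partial sums to `μ`.
-- Applied both ways, this gives independence of the generators.
lemma rNorm_le_of_isExpansion {r : ℝ} (hr : 1 / (p : ℝ) ≤ r) (hr1 : r ≤ 1) {d' : ℕ}
    {g' : Fin d' → G} {μ : CompletedGroupRing R G} {c : (Fin d' → ℕ) → R} (h : IsExpansion g' μ c)
    {A : ℝ} (hA : ∀ β, ‖c β‖ * r ^ (∑ j, β j) ≤ A) : rNorm (fun a : R => ‖a‖) r g μ ≤ A := by
  have hr0 : 0 < r := lt_of_lt_of_le (by have := (Fact.out : p.Prime).pos; positivity) hr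
  have hA0 : 0 ≤ A := le_trans (by positivity) (hA 0)
  refine ciSup_le fun α => ?_
  rw [hG.expansionCoeff_eq hg hR]
  obtain ⟨C, hC⟩ := h.bounded
  have hC0 : 0 ≤ C := (norm_nonneg _).trans (hC 0)
  refine le_of_tendsto ((hG.tendsto_coeffFunctional hg hR hC0
    (coeffBounded_partialSum hR g' hC0 hC) (tendsto_coeff_partialSum h) α).norm.mul_const _)
    (Eventually.of_forall fun F => ?_)
  rw [← le_div_iff₀ (by positivity), partialSum, map_sum]
  refine IsUltrametricDist.norm_sum_le_of_forall_le_of_nonneg (by positivity) fun β _ => ?_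
  rw [le_div_iff₀ (by positivity), map_smul, smul_eq_mul]
  obtain ⟨l, hl, hlβ⟩ := monomial_eq_augProduct (R := R) g' β
  rw [hlβ]
  have h1 := hG.norm_coeffFunctional_augProduct_mul_pow_le hg hR hr hr1 l α
  rw [hl] at h1
  calc _ ≤ ‖c β‖ * ‖hG.coeffFunctional hg hR α (augProduct R l)‖ * r ^ (∑ j, α j) :=
        mul_le_mul_of_nonneg_right (norm_mul_le _ _) (by positivity)
    _ ≤ ‖c β‖ * r ^ (∑ j, β j) := by
        rw [mul_assoc]
        exact mul_le_mul_of_nonneg_left h1 (norm_nonneg _)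
    _ ≤ A := hA β

lemma le_rNorm {r : ℝ} (hr : 0 ≤ r) (hr1 : r ≤ 1) (μ : CompletedGroupRing R G) (α : Fin d → ℕ) :
    ‖hG.coeffFunctional hg hR α μ‖ * r ^ (∑ j, α j) ≤ rNorm (fun a : R => ‖a‖) r g μ := by
  rw [← hG.expansionCoeff_eq hg hR]
  exact le_ciSup (hG.bddAbove_expansionCoeff hg hR hr hr1 μ) α

include hG hg in
lemma rNorm_le_rNorm {r : ℝ} (hr : 1 / (p : ℝ) ≤ r) (hr1 : r ≤ 1) {d' : ℕ} {g' : Fin d' → G}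
    (hg' : IsMinimalGenerators g') (μ : CompletedGroupRing R G) :
    rNorm (fun a : R => ‖a‖) r g μ ≤ rNorm (fun a : R => ‖a‖) r g' μ :=
  hG.rNorm_le_of_isExpansion hg hR hr hr1 (hG.isExpansion_coeffFunctional hg' hR μ) fun β =>
    hG.le_rNorm hg' hR (le_trans (by positivity) hr) hr1 μ β

include hG hg in
lemma rNorm_mul_le {r : ℝ} (hr : 1 / (p : ℝ) ≤ r) (hr1 : r ≤ 1) (μ ν : CompletedGroupRing R G) :
    rNorm (fun a : R => ‖a‖) r g (μ * ν) ≤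
      rNorm (fun a : R => ‖a‖) r g μ * rNorm (fun a : R => ‖a‖) r g ν := by
  classical
  have hr0 : 0 < r := lt_of_lt_of_le (by have := (Fact.out : p.Prime).pos; positivity) hr
  set A := rNorm (fun a : R => ‖a‖) r g μ
  set B := rNorm (fun a : R => ‖a‖) r g ν
  have hA : ∀ β, ‖hG.coeffFunctional hg hR β μ‖ * r ^ (∑ j, β j) ≤ A :=
    hG.le_rNorm hg hR hr0.le hr1 μ
  have hB : ∀ β, ‖hG.coeffFunctional hg hR β ν‖ * r ^ (∑ j, β j) ≤ B :=
    hG.le_rNorm hg hR hr0.le hr1 ν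
  have hA0 : 0 ≤ A := le_trans (by positivity) (hA 0)
  have hB0 : 0 ≤ B := le_trans (by positivity) (hB 0)
  obtain ⟨C, hC, hμ⟩ := exists_coeffBounded μ
  obtain ⟨D, hD, hν⟩ := exists_coeffBounded ν
  have hμe := hG.isExpansion_coeffFunctional hg hR μ
  have hνe := hG.isExpansion_coeffFunctional hg hR ν
  -- A coefficient of a product over the finite group `G/N` is a finite bilinear expression, so
  -- products of partial sums converge to `μ * ν`.
  have hlim : ∀ (N : OpenNormalSubgroup G) (x : G ⧸ (N : Subgroup G)),
      Tendsto (fun F => ((partialSum g (fun α => hG.coeffFunctional hg hR α μ) F *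
        partialSum g (fun α => hG.coeffFunctional hg hR α ν) F).1 N).coeff x) atTop
        (𝓝 (((μ * ν).1 N).coeff x)) := by
    intro N x
    have : Finite (G ⧸ (N : Subgroup G)) := by
      obtain ⟨k, hk⟩ := hG.index N
      have : (N : Subgroup G).FiniteIndex :=
        ⟨by rw [hk]; exact pow_ne_zero _ (Fact.out : p.Prime).ne_zero⟩
      infer_instance
    have := Fintype.ofFinite (G ⧸ (N : Subgroup G))
    have hmul : ∀ μ ν : CompletedGroupRing R G, (μ * ν).1 N = μ.1 N * ν.1 N := fun _ _ => rfl
    simp only [hmul, coeff_mul_eq_sum]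
    refine tendsto_finsetSum _ fun y _ => tendsto_finsetSum _ fun z _ => ?_
    split_ifs
    · exact (tendsto_coeff_partialSum hμe N y).mul (tendsto_coeff_partialSum hνe N z)
    · exact tendsto_const_nhds
  refine ciSup_le fun α => ?_
  rw [hG.expansionCoeff_eq hg hR]
  refine le_of_tendsto ((hG.tendsto_coeffFunctional hg hR (mul_nonneg hC hD) (fun F =>
    (coeffBounded_partialSum hR g hC (fun α => hG.norm_coeffFunctional_le hg hR α hC hμ) F).mul hC hD
      (coeffBounded_partialSum hR g hD (fun α => hG.norm_coeffFunctional_le hg hR α hD hν) F))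
    hlim α).norm.mul_const _) (Eventually.of_forall fun F => ?_)
  rw [← le_div_iff₀ (by positivity), partialSum, partialSum, Finset.sum_mul_sum, map_sum]
  refine IsUltrametricDist.norm_sum_le_of_forall_le_of_nonneg (by positivity) fun β _ => ?_
  rw [map_sum]
  refine IsUltrametricDist.norm_sum_le_of_forall_le_of_nonneg (by positivity) fun γ _ => ?_
  rw [le_div_iff₀ (by positivity), smul_mul_smul_comm, map_smul, smul_eq_mul]
  obtain ⟨l, hl, hlβ⟩ := monomial_eq_augProduct (R := R) g β
  obtain ⟨l', hl', hlγ⟩ := monomial_eq_augProduct (R := R) g γ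
  -- The product of two ordered monomials is not ordered, but it is a product of `|β| + |γ|`
  -- elements `[x] - 1`, which is all the key estimate requires.
  rw [hlβ, hlγ, ← augProduct_append]
  have h1 := hG.norm_coeffFunctional_augProduct_mul_pow_le hg hR hr hr1 (l ++ l') α
  rw [List.length_append, hl, hl', pow_add] at h1
  set a := hG.coeffFunctional hg hR β μ
  set b := hG.coeffFunctional hg hR γ ν
  calc _ ≤ (‖a‖ * ‖b‖) * ‖hG.coeffFunctional hg hR α (augProduct R (l ++ l'))‖ * r ^ (∑ j, α j) :=
        mul_le_mul_of_nonneg_right ((norm_mul_le _ _).trans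
          (mul_le_mul_of_nonneg_right (norm_mul_le _ _) (norm_nonneg _))) (by positivity)
    _ ≤ (‖a‖ * ‖b‖) * (r ^ (∑ j, β j) * r ^ (∑ j, γ j)) := by
        rw [mul_assoc]
        exact mul_le_mul_of_nonneg_left h1 (by positivity)
    _ = (‖a‖ * r ^ (∑ j, β j)) * (‖b‖ * r ^ (∑ j, γ j)) := by ring
    _ ≤ A * B := mul_le_mul (hA β) (hB γ) (by positivity) hA0

include hG hg in
lemma boundedEquivalent_rNorm {r : ℝ} (hr : 0 ≤ r) (hr1 : r ≤ 1) {f : R → ℝ}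
    (hf : BoundedEquivalent (fun a : R => ‖a‖) f) :
    BoundedEquivalent (rNorm (R := R) (G := G) (fun a : R => ‖a‖) r g) (rNorm f r g) := by
  obtain ⟨C₁, C₂, h₁, h₂, h⟩ := hf
  refine ⟨C₁, C₂, h₁, h₂, fun μ => ?_⟩
  have hb := hG.bddAbove_expansionCoeff hg hR hr hr1 μ
  have hle : ∀ α : Fin d → ℕ, f (expansionCoeff g μ α) * r ^ (∑ j, α j) ≤
      C₂ * (‖expansionCoeff g μ α‖ * r ^ (∑ j, α j)) := fun α => by
    rw [← mul_assoc]
    exact mul_le_mul_of_nonneg_right (h _).2 (by positivity)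
  have hb' : BddAbove (Set.range fun α : Fin d → ℕ =>
      f (expansionCoeff g μ α) * r ^ (∑ j, α j)) := by
    obtain ⟨A, hA⟩ := hb
    refine ⟨C₂ * A, ?_⟩
    rintro _ ⟨α, rfl⟩
    exact (hle α).trans (mul_le_mul_of_nonneg_left (hA ⟨α, rfl⟩) h₂.le)
  constructor
  · rw [rNorm, Real.mul_iSup_of_nonneg h₁.le]
    refine ciSup_le fun α => le_trans ?_ (le_ciSup hb' α)
    rw [← mul_assoc]
    exact mul_le_mul_of_nonneg_right (h _).1 (by positivity)
  · exact ciSup_le fun α => (hle α).trans (mul_le_mul_of_nonneg_left (le_ciSup hb α) h₂.le)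

end IsUniformProPGroup

theorem mainTheorem11 (p : ℕ) [Fact p.Prime]
    (G : Type*) [Group G] [TopologicalSpace G] [IsTopologicalGroup G]
    (hG : IsUniformProPGroup p G)
    (R : Type*) [NormedCommRing R] [NormOneClass R] [IsUltrametricDist R] [CompleteSpace R]
    [Algebra ℤ_[p] R] (hR : IsBanachTateAlgebra p R)
    (r : ℝ) (hr : 1 / (p : ℝ) ≤ r) (hr1 : r < 1) :
    -- the `r`-norms are well defined: expansions exist and are unique, and the suprema are finite
    (∀ (d : ℕ) (g : Fin d → G), IsMinimalGenerators g → ∀ μ : CompletedGroupRing R G,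
      (∃! c : (Fin d → ℕ) → R, IsExpansion g μ c) ∧
      BddAbove (Set.range fun α : Fin d → ℕ => ‖expansionCoeff g μ α‖ * r ^ (∑ i, α i))) ∧
    -- independence of the minimal ordered set of topological generators
    (∀ (d d' : ℕ) (g : Fin d → G) (g' : Fin d' → G),
      IsMinimalGenerators g → IsMinimalGenerators g' → ∀ μ : CompletedGroupRing R G,
      rNorm (fun a : R => ‖a‖) r g μ = rNorm (fun a : R => ‖a‖) r g' μ) ∧
    -- submultiplicativity
    (∀ (d : ℕ) (g : Fin d → G), IsMinimalGenerators g → ∀ μ ν : CompletedGroupRing R G,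
      rNorm (fun a : R => ‖a‖) r g (μ * ν) ≤
        rNorm (fun a : R => ‖a‖) r g μ * rNorm (fun a : R => ‖a‖) r g ν) ∧
    -- replacing the norm of `R` by a bounded-equivalent one
    (∀ f : RingNorm R, IsZpAlgebraNorm p f → BoundedEquivalent (fun a : R => ‖a‖) f →
      ∀ (d : ℕ) (g : Fin d → G), IsMinimalGenerators g →
      BoundedEquivalent (rNorm (R := R) (fun a : R => ‖a‖) r g) (rNorm (R := R) f r g)) := by

  have hR' := hR.norm_algebraMap_le
  have hr0 : 0 ≤ r := le_trans (by positivity) hr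
  refine ⟨fun d g hg μ => ⟨hG.existsUnique_isExpansion hg hR' μ,
    hG.bddAbove_expansionCoeff hg hR' hr0 hr1.le μ⟩, fun d d' g g' hg hg' μ => ?_,
    fun d g hg μ ν => hG.rNorm_mul_le hg hR' hr hr1.le μ ν,
    fun f _ hf d g hg => hG.boundedEquivalent_rNorm hg hR' hr0 hr1.le hf⟩
  exact le_antisymm (hG.rNorm_le_rNorm hg hR' hr hr1.le hg' μ)
    (hG.rNorm_le_rNorm hg' hR' hr hr1.le hg μ)
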